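/- For $n\ge 1$ let $\mathfrak M_n$ be the set of minimal factorizations of the $n$-cycle, i.e. of sequences $(\tau_1,\dots,\tau_{n-1})$ of transpositions of $\{1,\dots,n\}$ such that $\tau_1\tau_2\cdots\tau_{n-1}=(1,2,\dots,n)$, where permutations are multiplied from left to right ($\tau_1$ is applied first). For $F=(\tau_1,\dots,\tau_{n-1})\in\mathfrak M_n$ the graph on $\{1,\dots,n\}$ whose edges are the transpositions $\tau_i$, seen as two-element sets, is a tree; let $\mathcal E(F)$ be the pointed, edge-labelled, non-plane tree obtained from it by giving the label $i$ to the edge $\tau_i$, pointing at the vertex $1$, and forgetting the names of the vertices. For $\alpha>0$, $\alpha\cdot\tau$ denotes the tree $\tau$ with all edge labels multiplied by $\alpha$. Consider the set of all locally finite (finite or infinite), non-plane, pointed trees whose edges carry pairwise distinct real labels, up to isomorphism, with the local topology: $\tau_n\to\tau$ if and only if, for every $h\ge1$, the balls of radius $h$ around the pointed vertices of $\tau_n$ and of $\tau$ coincide as unlabelled pointed trees for $n$ large enough, under identifications for which the edge labels of the ball of $\tau_n$ converge to those of the ball of $\tau$. Let $\mu_k=e^{-1}/k!$ $(k\ge0)$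 be the $\mathrm{Poisson}(1)$ distribution and $\overline\mu_k=k\mu_k$ its size-biased version. Kesten's tree $\mathscr T_\infty$ is the random plane tree with two types of vertices, normal and special, in which the root is special; normal vertices have offspring numbers of law $\mu$ and special vertices have offspring numbers of law $\overline\mu$, all independent; all children of a normal vertex are normal; and among the children of a special vertex one, selected uniformly at random and independently, is special, the others being normal. Let $\mathscr T^u_\infty$ be $\mathscr T_\infty$ with edges labelled by i.i.d. random variables uniform on $[0,1]$, independent of $\mathscr T_\infty$, and let $\mathsf{Shape}(\mathscr T^u_\infty)$ be the non-plane edge-labelled tree obtained by forgetting the planar structure and pointing at the root. **Proposition.** For every $n\ge 1$ let $\mathscr F_n$ be a uniform random element of $\mathfrak M_n$. Then $$\frac1n\cdot\mathcal E(\mathscr F_n)\ \xrightarrow[n\to\infty]{(d)}\ \mathsf{Shape}(\mathscr T^u_\infty)$$ in distribution, for the local topology, in the set of all locally finite, non-plane, pointed, edge-labelled trees. -/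

import Mathlib

open MeasureTheory ProbabilityTheory Filter Topology

noncomputable section

/-! ### Pointed, edge-labelled, non-plane trees -/

/-- A locally finite (possibly infinite) tree with a distinguished vertex `root`, all of whose edges
carry pairwise distinct real labels. Only the values of `label` on edges are meaningful. Since a
connected locally finite graph is countable, vertex sets in `Type` give every such tree up to
isomorphism. -/
structure PointedETree where
  V : Type
  graph : SimpleGraph V
  isTree : graph.IsTree
  locallyFinite : ∀ v, (graph.neighborSet v).Finite
  root : V
  label : Sym2 V → ℝ
  label_injOn : Set.InjOn label graph.edgeSet

namespace PointedETree

/-- Isomorphism of pointed edge-labelled trees. -/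
def Iso (A B : PointedETree) : Prop :=
  ∃ φ : A.graph ≃g B.graph, φ A.root = B.root ∧
    ∀ x y, A.graph.Adj x y → B.label s(φ x, φ y) = A.label s(x, y)

theorem Iso.refl (A : PointedETree) : Iso A A :=
  ⟨RelIso.refl _, rfl, fun _ _ _ => rfl⟩

theorem Iso.symm {A B : PointedETree} (h : Iso A B) : Iso B A := by
  obtain ⟨φ, hr, hl⟩ := h
  refine ⟨φ.symm, ?_, fun x y hxy => ?_⟩
  · rw [← hr]; exact φ.symm_apply_apply _
  · have := hl (φ.symm x) (φ.symm y) (φ.symm.map_rel_iff.2 hxy)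
    rw [← this]
    simp

theorem Iso.trans {A B C : PointedETree} (h : Iso A B) (h' : Iso B C) : Iso A C := by
  obtain ⟨φ, hr, hl⟩ := h
  obtain ⟨ψ, hr', hl'⟩ := h'
  refine ⟨φ.trans ψ, ?_, fun x y hxy => ?_⟩
  · simp [hr, hr']
  · have := hl' (φ x) (φ y) (φ.map_rel_iff.2 hxy)
    simp only [RelIso.trans_apply]
    rw [this, hl x y hxy]

instance setoid : Setoid PointedETree where
  r := Iso
  iseqv := ⟨Iso.refl, Iso.symm, Iso.trans⟩

/-- The vertices at distance at most `h` from the pointed vertex. -/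
def ballSet (A : PointedETree) (h : ℕ) : Set A.V := {v | A.graph.dist A.root v ≤ h}

/-- The graph of the ball of radius `h`: the vertices at distance at most `h` from the pointed
vertex, together with the edges between them. -/
abbrev ballGraph (A : PointedETree) (h : ℕ) : SimpleGraph (A.ballSet h) :=
  A.graph.induce (A.ballSet h)

theorem root_mem_ballSet (A : PointedETree) (h : ℕ) : A.root ∈ A.ballSet h := by
  simp [ballSet]

/-- The balls of radius `h` of `A` and `B` coincide as unlabelled pointed trees, through an
identification under which corresponding edge labels differ by less than `ε`. -/
def Close (h : ℕ) (ε : ℝ) (A B : PointedETree) : Prop :=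
  ∃ φ : A.ballGraph h ≃g B.ballGraph h,
    φ ⟨A.root, A.root_mem_ballSet h⟩ = ⟨B.root, B.root_mem_ballSet h⟩ ∧
    ∀ x y, (A.ballGraph h).Adj x y →
      |B.label s((φ x : B.V), (φ y : B.V)) - A.label s((x : A.V), (y : A.V))| < ε

theorem Close.trans {h : ℕ} {ε δ : ℝ} {A B C : PointedETree} (hAB : A.Close h ε B)
    (hBC : B.Close h δ C) : A.Close h (ε + δ) C := by
  obtain ⟨φ, hr, hl⟩ := hAB
  obtain ⟨ψ, hr', hl'⟩ := hBC
  refine ⟨φ.trans ψ, by simp [hr, hr'], fun x y hxy => ?_⟩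
  have h1 := hl x y hxy
  have h2 := hl' (φ x) (φ y) (φ.map_rel_iff.2 hxy)
  have h3 := abs_sub_le (C.label s((ψ (φ x) : C.V), (ψ (φ y) : C.V)))
    (B.label s((φ x : B.V), (φ y : B.V))) (A.label s((x : A.V), (y : A.V)))
  simp only [RelIso.trans_apply]
  linarith

theorem dist_map_le {V W : Type} {G : SimpleGraph V} {H : SimpleGraph W} (φ : G ≃g H)
    (hG : G.Connected) (x y : V) : H.dist (φ x) (φ y) ≤ G.dist x y := by
  obtain ⟨p, hp⟩ := hG.exists_walk_length_eq_dist x y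
  rw [← hp, ← SimpleGraph.Walk.length_map φ.toHom p]
  exact SimpleGraph.dist_le _

theorem Iso.close {A B : PointedETree} (hAB : A.Iso B) (h : ℕ) {ε : ℝ} (hε : 0 < ε) :
    A.Close h ε B := by
  obtain ⟨φ, hr, hl⟩ := hAB
  have hd : ∀ v, v ∈ A.ballSet h ↔ φ v ∈ B.ballSet h := by
    intro v
    have h1 := dist_map_le φ A.isTree.connected A.root v
    have h2 := dist_map_le φ.symm B.isTree.connected (φ A.root) (φ v)
    simp only [RelIso.symm_apply_apply] at h2
    simp only [ballSet, Set.mem_ofPred_eq, ← hr]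
    omega
  refine ⟨⟨φ.toEquiv.subtypeEquiv hd, φ.map_rel_iff⟩, Subtype.ext hr, fun x y hxy => ?_⟩
  have := hl x y hxy
  change |B.label s(φ x, φ y) - _| < ε
  rw [this]
  simpa using hε

theorem finite_ballSet (A : PointedETree) (h : ℕ) : (A.ballSet h).Finite := by
  induction h with
  | zero =>
    refine (Set.finite_singleton A.root).subset fun v hv => ?_
    have : A.graph.dist A.root v = 0 := Nat.le_zero.1 hv
    exact ((A.isTree.connected.dist_eq_zero_iff).1 this).symm
  | succ h ih =>
    refine (ih.union (ih.biUnion fun v _ => A.locallyFinite v)).subset fun v hv => ?_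
    obtain ⟨p, hp⟩ := A.isTree.connected.exists_walk_length_eq_dist v A.root
    rw [SimpleGraph.dist_comm] at hp
    have hv : A.graph.dist A.root v ≤ h + 1 := hv
    cases p with
    | nil => exact Or.inl (A.root_mem_ballSet h)
    | @cons _ w _ hvw q =>
      right
      have hq : A.graph.dist A.root w ≤ q.length := by
        rw [SimpleGraph.dist_comm]; exact SimpleGraph.dist_le q
      simp only [SimpleGraph.Walk.length_cons] at hp
      refine Set.mem_biUnion (x := w) ?_ hvw.symm
      simp only [ballSet, Set.mem_ofPred_eq]
      omega

theorem Close.exists_lt {h : ℕ} {ε : ℝ} {A B : PointedETree} (hAB : A.Close h ε B)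
    (hε : 0 < ε) : ∃ δ, δ < ε ∧ A.Close h δ B := by
  obtain ⟨φ, hr, hl⟩ := hAB
  have := (A.finite_ballSet h).to_subtype
  let f : A.ballSet h × A.ballSet h → ℝ := fun p =>
    |B.label s((φ p.1 : B.V), (φ p.2 : B.V)) - A.label s((p.1 : A.V), (p.2 : A.V))|
  have hfin : (f '' {p | (A.ballGraph h).Adj p.1 p.2} ∪ {0}).Finite :=
    ((Set.toFinite _).image f).union (Set.finite_singleton 0)
  obtain ⟨δ, hδ, hmax⟩ := hfin.exists_maximal ⟨0, Or.inr rfl⟩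
  have hle : ∀ r ∈ f '' {p | (A.ballGraph h).Adj p.1 p.2} ∪ {0}, r ≤ δ := fun r hr' => by
    rcases le_total r δ with h1 | h1
    · exact h1
    · exact hmax hr' h1
  have hlt : δ < ε := by
    rcases hδ with ⟨p, hp, rfl⟩ | rfl
    · exact hl _ _ hp
    · exact hε
  refine ⟨(δ + ε) / 2, by linarith, φ, hr, fun x y hxy => ?_⟩
  have : f (x, y) ≤ δ := hle _ (Or.inl ⟨(x, y), hxy, rfl⟩)
  change f (x, y) < _
  linarith

/-- The tree `α · A`, obtained by multiplying all edge labels by `α > 0`. -/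
def scale (α : ℝ) (hα : 0 < α) (A : PointedETree) : PointedETree where
  V := A.V
  graph := A.graph
  isTree := A.isTree
  locallyFinite := A.locallyFinite
  root := A.root
  label e := α * A.label e
  label_injOn := fun _ he _ he' h => A.label_injOn he he' (mul_left_cancel₀ hα.ne' h)

/-- The tree with one vertex. -/
def single : PointedETree where
  V := Unit
  graph := ⊥
  isTree := SimpleGraph.IsTree.of_subsingleton
  locallyFinite := fun _ => Set.toFinite _
  root := ()
  label _ := 0
  label_injOn := by simp

end PointedETree

/-- The set of all locally finite, non-plane, pointed, edge-labelled trees (up to isomorphism). -/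
def ETree : Type 1 := Quotient PointedETree.setoid

namespace ETree

/-- The isomorphism class of a pointed edge-labelled tree. -/
def mk (A : PointedETree) : ETree := Quotient.mk _ A

/-- The local topology: it is generated by the sets of all trees that are `Close h ε` to a given
tree `τ`. A sequence `τ n` converges to `τ` if and only if, for each `h`, the balls of radius `h` of
`τ n` and `τ` coincide for `n` large and their edge labels converge
(see `ETree.tendsto_iff_close`). -/
instance : TopologicalSpace ETree :=
  TopologicalSpace.generateFrom
    {U | ∃ (A : PointedETree) (h : ℕ) (ε : ℝ), 0 < ε ∧
      U = {τ : ETree | ∃ B : PointedETree, τ = ETree.mk B ∧ A.Close h ε B}}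

instance : MeasurableSpace ETree := borel ETree

instance : BorelSpace ETree := ⟨rfl⟩

/-- Convergence in the local topology. -/
theorem tendsto_iff_close {ι : Type*} {l : Filter ι} (τ : ι → ETree) (A : PointedETree) :
    Tendsto τ l (𝓝 (ETree.mk A)) ↔
      ∀ (h : ℕ) (ε : ℝ), 0 < ε →
        ∀ᶠ i in l, ∃ B : PointedETree, τ i = ETree.mk B ∧ A.Close h ε B := by
  refine TopologicalSpace.tendsto_nhds_generateFrom_iff.trans ?_
  constructor
  · intro H h ε hε
    exact H _ ⟨A, h, ε, hε, rfl⟩ ⟨A, rfl, (PointedETree.Iso.refl A).close h hε⟩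
  · rintro H _ ⟨A₀, h, ε, hε, rfl⟩ ⟨B₀, hB₀, hclose⟩
    have hiso : B₀.Iso A := (Quotient.exact hB₀).symm
    obtain ⟨δ, hlt, hclose⟩ := hclose.exists_lt hε
    filter_upwards [H h ((ε - δ) / 2) (by linarith)] with i hi
    obtain ⟨B, hB, hAB⟩ := hi
    refine ⟨B, hB, ?_⟩
    have := (hclose.trans (hiso.close h (ε := (ε - δ) / 2) (by linarith))).trans hAB
    convert this using 1
    ring

/-- The tree `α · τ`, obtained by multiplying all edge labels by `α > 0`. -/
def scale (α : ℝ) (hα : 0 < α) : ETree → ETree :=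
  Quotient.map (PointedETree.scale α hα) (by
    rintro A B ⟨φ, hr, hl⟩
    exact ⟨φ, hr, fun x y hxy => congrArg (α * ·) (hl x y hxy)⟩)

end ETree

/-! ### Minimal factorizations and their trees -/

/-- Minimal factorizations of the `n`-cycle `(1, 2, …, n)`: sequences of `n - 1` transpositions
whose product is the cycle. Points are numbered `0, …, n - 1` instead of `1, …, n`. Permutations
are multiplied from left to right (the first one in the sequence is applied first), whence the
`reverse`, as `*` on `Equiv.Perm` composes from right to left. -/
def MinimalFactorization (n : ℕ) : Type :=
  {t : Fin (n - 1) → Equiv.Perm (Fin n) //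
    (∀ i, (t i).IsSwap) ∧ (List.ofFn t).reverse.prod = finRotate n}

instance (n : ℕ) : MeasurableSpace (MinimalFactorization n) := ⊤

namespace MinimalFactorization

variable {n : ℕ}

/-- The graph with vertex set `{0, …, n - 1}` whose edges are the (supports of the) transpositions
of the factorization. -/
def graph (F : MinimalFactorization n) : SimpleGraph (Fin n) where
  Adj x y := x ≠ y ∧ ∃ i, F.1 i = Equiv.swap x y
  symm := ⟨fun x y ⟨hne, i, hi⟩ => ⟨hne.symm, i, hi.trans (Equiv.swap_comm x y)⟩⟩
  loopless := ⟨fun _ h => h.1 rfl⟩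

/-- The edge given by the `i`-th transposition (`i = 0, …, n - 2`) gets the label `i + 1`. As the
transpositions are pairwise distinct, the sum has a single nonzero term at every edge. -/
def label (F : MinimalFactorization n) : Sym2 (Fin n) → ℝ :=
  Sym2.lift ⟨fun x y => ∑ i : Fin (n - 1), if F.1 i = Equiv.swap x y then (i : ℝ) + 1 else 0,
    fun x y => by simp only [Equiv.swap_comm x y]⟩

theorem swap_eq_imp {α : Type*} [DecidableEq α] {x y a b : α} (hxy : x ≠ y)
    (h : Equiv.swap x y = Equiv.swap a b) : s(x, y) = s(a, b) := by
  have h1 : Equiv.swap a b x = y := by rw [← h]; simp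
  have h2 : Equiv.swap a b y = x := by rw [← h]; simp
  rw [Sym2.eq_iff]
  by_cases hxa : x = a
  · left; subst hxa; simpa [eq_comm] using h1
  · by_cases hxb : x = b
    · right; subst hxb; simpa [eq_comm] using h1
    · exact absurd (by simpa [Equiv.swap_apply_of_ne_of_ne hxa hxb] using h1) hxy

theorem reachable_prod (F : MinimalFactorization n) (l : List (Equiv.Perm (Fin n)))
    (hl : ∀ σ ∈ l, ∃ i, F.1 i = σ) (x : Fin n) : F.graph.Reachable x (l.prod x) := by
  induction l with
  | nil => simp
  | cons σ l ih =>
    have h1 := ih fun τ hτ => hl τ (List.mem_cons_of_mem _ hτ)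
    obtain ⟨i, hi⟩ := hl σ List.mem_cons_self
    rw [List.prod_cons, Equiv.Perm.mul_apply]
    refine h1.trans ?_
    generalize l.prod x = z
    by_cases hz : σ z = z
    · rw [hz]
    · refine SimpleGraph.Adj.reachable ⟨Ne.symm hz, i, ?_⟩
      obtain ⟨a, b, _, hab⟩ := F.2.1 i
      rw [hi] at hab
      rw [hi, hab]
      rcases eq_or_ne z a with rfl | hza
      · simp
      · rcases eq_or_ne z b with rfl | hzb
        · simp [Equiv.swap_comm]
        · exact absurd (by rw [hab, Equiv.swap_apply_of_ne_of_ne hza hzb]) hz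

theorem connected [NeZero n] (F : MinimalFactorization n) : F.graph.Connected := by
  have step : ∀ x, F.graph.Reachable x (finRotate n x) := fun x => by
    rw [← F.2.2]
    refine F.reachable_prod _ (fun σ hσ => ?_) x
    simpa [List.mem_ofFn] using hσ
  have h0 : ∀ (k : ℕ) (hk : k < n), F.graph.Reachable 0 ⟨k, hk⟩ := by
    intro k
    induction k with
    | zero => intro hk; exact SimpleGraph.Reachable.refl _
    | succ k ih =>
      intro hk
      refine (ih (by omega)).trans ?_
      have := step ⟨k, by omega⟩
      obtain ⟨m, rfl⟩ : ∃ m, n = m + 1 := ⟨n - 1, by omega⟩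
      rwa [finRotate_of_lt (by omega)] at this
  have : Nonempty (Fin n) := ⟨0⟩
  exact ⟨fun x y => (h0 x x.2).symm.trans (h0 y y.2)⟩

/-- A choice of the edge given by the `i`-th transposition. -/
theorem exists_edge (F : MinimalFactorization n) (i : Fin (n - 1)) :
    ∃ e : Sym2 (Fin n), ∀ x y, x ≠ y → F.1 i = Equiv.swap x y → s(x, y) = e := by
  obtain ⟨a, b, _, hab⟩ := F.2.1 i
  exact ⟨s(a, b), fun x y hxy h => swap_eq_imp hxy (h.symm.trans hab)⟩

theorem exists_index (F : MinimalFactorization n) (e : F.graph.edgeSet) :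
    ∃ i, ∀ x y, e.1 = s(x, y) → F.1 i = Equiv.swap x y := by
  obtain ⟨e, he⟩ := e
  induction e using Sym2.ind with
  | _ x y =>
    obtain ⟨_, i, hi⟩ := he
    refine ⟨i, fun a b hab => ?_⟩
    rcases Sym2.eq_iff.1 hab with ⟨rfl, rfl⟩ | ⟨rfl, rfl⟩
    · exact hi
    · rw [hi, Equiv.swap_comm]

/-- The map from the edges to the indices of the corresponding transpositions. -/
theorem exists_index_equiv [NeZero n] (F : MinimalFactorization n) :
    ∃ f : F.graph.edgeSet → Fin (n - 1), Function.Bijective f ∧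
      (∀ e x y, e.1 = s(x, y) → F.1 (f e) = Equiv.swap x y) ∧
      Nat.card F.graph.edgeSet + 1 = Nat.card (Fin n) := by
  choose f hf using F.exists_index
  have hinj : Function.Injective f := by
    rintro ⟨e, he⟩ ⟨e', he'⟩ hee
    induction e using Sym2.ind with
    | _ x y =>
      induction e' using Sym2.ind with
      | _ a b =>
        have h1 := hf ⟨s(x, y), he⟩ x y rfl
        have h2 := hf ⟨s(a, b), he'⟩ a b rfl
        rw [hee] at h1
        exact Subtype.ext (swap_eq_imp he.1 (h1.symm.trans h2))
  have hn : 0 < n := Nat.pos_of_ne_zero (NeZero.ne n)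
  have hle := Nat.card_le_card_of_injective f hinj
  have hge := F.connected.card_vert_le_card_edgeSet_add_one
  rw [Nat.card_fin] at hle hge
  have hcard : Nat.card F.graph.edgeSet = Nat.card (Fin (n - 1)) := by
    rw [Nat.card_fin]
    omega
  refine ⟨f, (Nat.bijective_iff_injective_and_card f).2 ⟨hinj, hcard⟩, hf, ?_⟩
  rw [Nat.card_fin] at hcard ⊢
  omega

theorem isTree [NeZero n] (F : MinimalFactorization n) : F.graph.IsTree := by
  obtain ⟨_, _, _, h⟩ := F.exists_index_equiv
  exact SimpleGraph.isTree_iff_connected_and_card.2 ⟨F.connected, h⟩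

/-- The label of the edge given by the `i`-th transposition is `i + 1`. -/
theorem label_eq [NeZero n] (F : MinimalFactorization n) {x y : Fin n} (hxy : x ≠ y)
    {i : Fin (n - 1)} (hi : F.1 i = Equiv.swap x y) : F.label s(x, y) = (i : ℝ) + 1 := by
  obtain ⟨f, hf, hswap, _⟩ := F.exists_index_equiv
  have key : ∀ j, F.1 j = Equiv.swap x y → ∀ h : s(x, y) ∈ F.graph.edgeSet,
      j = f ⟨s(x, y), h⟩ := by
    intro j hj h
    obtain ⟨⟨e, he⟩, rfl⟩ := hf.2 j
    induction e using Sym2.ind with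
    | _ a b =>
      have := hswap ⟨s(a, b), he⟩ a b rfl
      congr 1
      exact Subtype.ext (swap_eq_imp he.1 (this.symm.trans hj))
  have hmem : s(x, y) ∈ F.graph.edgeSet := ⟨hxy, i, hi⟩
  simp only [label, Sym2.lift_mk]
  rw [Finset.sum_eq_single i, if_pos hi]
  · intro j _ hji
    rw [if_neg]
    exact fun hj => hji ((key j hj hmem).trans (key i hi hmem).symm)
  · simp

theorem label_injOn [NeZero n] (F : MinimalFactorization n) :
    Set.InjOn F.label F.graph.edgeSet := by
  intro e he e' he' h
  induction e using Sym2.ind with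
  | _ x y =>
    induction e' using Sym2.ind with
    | _ a b =>
      obtain ⟨hxy, i, hi⟩ := he
      obtain ⟨hab, j, hj⟩ := he'
      rw [F.label_eq hxy hi, F.label_eq hab hj] at h
      have hij : i = j := Fin.ext (by exact_mod_cast add_right_cancel h)
      subst hij
      exact swap_eq_imp hxy (hi.symm.trans hj)

/-- The tree of the factorization, with the edge of the `i`-th transposition labelled `i`, pointed
at the vertex `1` (here the vertex `0`); the other vertex labels are forgotten. -/
def toETree [NeZero n] (F : MinimalFactorization n) : ETree :=
  ETree.mk
    { V := Fin n
      graph := F.graph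
      isTree := F.isTree
      locallyFinite := fun _ => Set.toFinite _
      root := 0
      label := F.label
      label_injOn := F.label_injOn }

end MinimalFactorization

/-! ### Plane trees and their shapes -/

/-- Locally finite plane trees, as sets of words. The word `u₁ u₂ … u_m` is stored as the list
`[u_m, …, u₂, u₁]`, so that `i :: u` is the child number `i` of `u`; children are numbered from
`0`. -/
structure PlaneTree where
  carrier : Set (List ℕ)
  nil_mem : [] ∈ carrier
  parent_mem : ∀ i u, i :: u ∈ carrier → u ∈ carrier
  children : ∀ u ∈ carrier, ∃ k : ℕ, ∀ i, i :: u ∈ carrier ↔ i < k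

namespace PlaneTree

/-- The graph of a plane tree: every vertex is joined to its children. -/
def graph (τ : PlaneTree) : SimpleGraph τ.carrier where
  Adj u v := (∃ i, (v : List ℕ) = i :: u) ∨ ∃ i, (u : List ℕ) = i :: v
  symm := ⟨fun _ _ h => h.symm⟩
  loopless := ⟨fun u h => by
    rcases h with ⟨i, h⟩ | ⟨i, h⟩ <;> simpa using congrArg List.length h⟩

theorem reachable_nil (τ : PlaneTree) (u : List ℕ) (hu : u ∈ τ.carrier) :
    τ.graph.Reachable ⟨[], τ.nil_mem⟩ ⟨u, hu⟩ := by
  induction u with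
  | nil => exact SimpleGraph.Reachable.refl _
  | cons i u ih =>
    exact (ih (τ.parent_mem i u hu)).trans (SimpleGraph.Adj.reachable (Or.inl ⟨i, rfl⟩))

theorem isBridge_aux (τ : PlaneTree) (u v : τ.carrier) (i : ℕ)
    (hv : (v : List ℕ) = i :: u) : ¬ (τ.graph.deleteEdges {s(u, v)}).Reachable v u := by
  rintro ⟨p⟩
  have key : ∀ a b : τ.carrier, (τ.graph.deleteEdges {s(u, v)}).Walk a b →
      (v : List ℕ) <:+ a → (v : List ℕ) <:+ b := by
    intro a b p
    induction p with
    | nil => exact id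
    | @cons a b c hab _ ih =>
      intro ha
      refine ih ?_
      rw [SimpleGraph.deleteEdges_adj] at hab
      obtain ⟨hab, hne⟩ := hab
      rcases hab with ⟨j, hj⟩ | ⟨j, hj⟩
      · rw [hj]; exact ha.trans (List.suffix_cons _ _)
      · rw [hj, List.suffix_cons_iff] at ha
        rcases ha with ha | ha
        · exfalso
          apply hne
          have h1 : v = a := Subtype.ext (ha.trans hj.symm)
          have h2 : u = b := by
            rw [hv] at ha
            exact Subtype.ext (List.cons.inj ha).2
          rw [h1, h2]
          exact Sym2.eq_swap
        · exact ha
  have := (key v u p (List.suffix_refl _)).length_le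
  rw [hv] at this
  simp at this

theorem isTree (τ : PlaneTree) : τ.graph.IsTree := by
  have : Nonempty τ.carrier := ⟨⟨[], τ.nil_mem⟩⟩
  refine ⟨⟨fun x y => (τ.reachable_nil x x.2).symm.trans (τ.reachable_nil y y.2)⟩, ?_⟩
  rw [SimpleGraph.isAcyclic_iff_forall_adj_isBridge]
  intro u v huv
  rw [SimpleGraph.isBridge_iff]
  rcases huv with ⟨i, h⟩ | ⟨i, h⟩
  · exact fun hr => τ.isBridge_aux u v i h hr.symm
  · rw [Sym2.eq_swap]
    exact τ.isBridge_aux v u i h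

theorem locallyFinite (τ : PlaneTree) (u : τ.carrier) : (τ.graph.neighborSet u).Finite := by
  obtain ⟨k, hk⟩ := τ.children u u.2
  refine Set.Finite.of_finite_image (f := Subtype.val) ?_ Subtype.val_injective.injOn
  refine (((Set.finite_Iio k).image fun i => i :: (u : List ℕ)).union
    (Set.finite_singleton (u : List ℕ).tail)).subset ?_
  rintro _ ⟨v, hv, rfl⟩
  rcases hv with ⟨i, h⟩ | ⟨i, h⟩
  · left
    exact ⟨i, (hk i).1 (h ▸ v.2), h.symm⟩
  · right
    simp [h]

/-- Labels of the edges of a plane tree: `ℓ v` is the label of the edge joining `v ≠ ∅` to its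
parent. -/
def edgeLabel (τ : PlaneTree) (ℓ : List ℕ → ℝ) : Sym2 τ.carrier → ℝ :=
  Sym2.lift ⟨fun u v =>
    if (u : List ℕ).length < (v : List ℕ).length then ℓ v
    else if (v : List ℕ).length < (u : List ℕ).length then ℓ u else 0,
    fun u v => by
      rcases lt_trichotomy (u : List ℕ).length (v : List ℕ).length with h | h | h
      · simp [h, h.not_gt]
      · simp [h]
      · simp [h, h.not_gt]⟩

theorem edgeLabel_cons (τ : PlaneTree) (ℓ : List ℕ → ℝ) (u v : τ.carrier) (i : ℕ)
    (h : (v : List ℕ) = i :: u) : τ.edgeLabel ℓ s(u, v) = ℓ v := by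
  simp [edgeLabel, h]

/-- The edge labels of the plane tree `τ` are pairwise distinct. -/
def DistinctLabels (τ : PlaneTree) (ℓ : List ℕ → ℝ) : Prop :=
  Set.InjOn ℓ {u | u ∈ τ.carrier ∧ u ≠ []}

theorem edgeLabel_injOn (τ : PlaneTree) (ℓ : List ℕ → ℝ) (hℓ : τ.DistinctLabels ℓ) :
    Set.InjOn (τ.edgeLabel ℓ) τ.graph.edgeSet := by
  have norm : ∀ e ∈ τ.graph.edgeSet, ∃ (u v : τ.carrier) (i : ℕ),
      e = s(u, v) ∧ (v : List ℕ) = i :: u := by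
    intro e he
    induction e using Sym2.ind with
    | _ u v =>
      rcases he with ⟨i, h⟩ | ⟨i, h⟩
      · exact ⟨u, v, i, rfl, h⟩
      · exact ⟨v, u, i, Sym2.eq_swap, h⟩
  intro e he e' he' h
  obtain ⟨u, v, i, rfl, hv⟩ := norm e he
  obtain ⟨u', v', i', rfl, hv'⟩ := norm e' he'
  rw [τ.edgeLabel_cons ℓ u v i hv, τ.edgeLabel_cons ℓ u' v' i' hv'] at h
  have hvv := hℓ ⟨v.2, by simp [hv]⟩ ⟨v'.2, by simp [hv']⟩ h
  have huu : (u : List ℕ) = u' := by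
    rw [hv, hv'] at hvv
    exact (List.cons.inj hvv).2
  rw [Subtype.ext hvv, Subtype.ext huu]

/-- The shape of an edge-labelled plane tree: forget the planar structure and point at the root. -/
def shape (τ : PlaneTree) (ℓ : List ℕ → ℝ) (hℓ : τ.DistinctLabels ℓ) : ETree :=
  ETree.mk
    { V := τ.carrier
      graph := τ.graph
      isTree := τ.isTree
      locallyFinite := τ.locallyFinite
      root := ⟨[], τ.nil_mem⟩
      label := τ.edgeLabel ℓ
      label_injOn := τ.edgeLabel_injOn ℓ hℓ }

end PlaneTree

/-! ### Kesten's tree with Poisson(1) offspring distribution and i.i.d. uniform edge labels -/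

/-- The size-biased version of an offspring distribution: `k` has mass `k * μ {k}`. -/
def sizeBiased (μ : Measure ℕ) : Measure ℕ := μ.withDensity fun k => (k : ENNReal)

/-- The law of `(K, J)`, where `K` has the size-biased law and, given `K`, the index `J` is uniform
in `{0, …, K - 1}`. -/
def spineLaw (μ : Measure ℕ) : Measure (ℕ × ℕ) :=
  (sizeBiased μ).bind fun k => (uniformOn (Set.Iio k)).map (Prod.mk k)

theorem lintegral_id_poissonMeasure_one :
    ∫⁻ k : ℕ, (k : ENNReal) ∂(poissonMeasure 1) = 1 := by
  have h1 : ∀ k : ℕ, ((k + 1 : ℕ) : ENNReal) * poissonMeasure 1 {k + 1} =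
      poissonMeasure 1 {k} := by
    intro k
    rw [poissonMeasure_singleton, poissonMeasure_singleton,
      ← ENNReal.ofReal_natCast, ← ENNReal.ofReal_mul (by positivity)]
    congr 1
    rw [Nat.factorial_succ]
    have := Nat.factorial_ne_zero k
    push_cast
    field_simp
    simp
  rw [lintegral_countable', tsum_eq_zero_add' ENNReal.summable]
  simp only [Nat.cast_zero, zero_mul, zero_add, h1]
  have := measure_iUnion (μ := poissonMeasure 1) (f := fun k : ℕ => {k})
    (fun i j hij => by simpa using hij) (fun k => measurableSet_singleton k)
  rw [← this, Set.iUnion_of_singleton, measure_univ]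

instance : IsProbabilityMeasure (spineLaw (poissonMeasure 1)) := by
  refine ⟨?_⟩
  have hk : ∀ k : ℕ, (k : ENNReal) *
      ((uniformOn (Set.Iio k)).map (Prod.mk k) : Measure (ℕ × ℕ)) Set.univ = k := by
    intro k
    rcases Nat.eq_zero_or_pos k with rfl | hpos
    · simp
    · have : IsProbabilityMeasure (uniformOn (Set.Iio k)) :=
        isProbabilityMeasure_uniformOn (Set.finite_Iio k) ⟨0, hpos⟩
      rw [Measure.map_apply (measurable_of_countable _) MeasurableSet.univ]
      simp
  unfold spineLaw sizeBiased
  rw [Measure.bind_apply MeasurableSet.univ (measurable_of_countable _).aemeasurable,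
    lintegral_withDensity_eq_lintegral_mul _ (measurable_of_countable _)
      (measurable_of_countable _)]
  simp only [Pi.mul_apply, hk]
  exact lintegral_id_poissonMeasure_one

/-- The random data attached to a vertex: the number of children that it has if it is normal; the
number of children that it has and the index of its special child if it is special; and the label
of the edge to its parent (not used at the root). -/
abbrev VertexData : Type := ℕ × (ℕ × ℕ) × ℝ

/-- The law of the data of a vertex; the three components are independent. -/
def vertexLaw : Measure VertexData :=
  (poissonMeasure 1).prod
    ((spineLaw (poissonMeasure 1)).prod (volume.restrict (Set.Icc (0 : ℝ) 1)))

instance : IsProbabilityMeasure (volume.restrict (Set.Icc (0 : ℝ) 1)) := ⟨by simp⟩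

instance : IsProbabilityMeasure vertexLaw := by
  unfold vertexLaw
  infer_instance

/-- The law of the data of all the vertices, which are independent and identically distributed. -/
def kestenLaw : Measure (List ℕ → VertexData) := Measure.infinitePi fun _ => vertexLaw

instance : IsProbabilityMeasure kestenLaw := by
  unfold kestenLaw
  infer_instance

/-- The root is special, and the children of a special vertex are normal except for the one that is
selected. -/
def IsSpecial (ω : List ℕ → VertexData) : List ℕ → Prop
  | [] => True
  | i :: u => IsSpecial ω u ∧ i = (ω u).2.1.2

open Classical in
/-- The number of children of a vertex. -/
def kestenOffspring (ω : List ℕ → VertexData) (u : List ℕ) : ℕ :=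
  if IsSpecial ω u then (ω u).2.1.1 else (ω u).1

/-- Membership of a word in Kesten's tree. -/
def KestenMem (ω : List ℕ → VertexData) : List ℕ → Prop
  | [] => True
  | i :: u => KestenMem ω u ∧ i < kestenOffspring ω u

/-- Kesten's plane tree. -/
def kestenTree (ω : List ℕ → VertexData) : PlaneTree where
  carrier := {u | KestenMem ω u}
  nil_mem := trivial
  parent_mem := fun _ _ h => h.1
  children := fun u hu => ⟨kestenOffspring ω u, fun _ => ⟨fun h => h.2, fun h => ⟨hu, h⟩⟩⟩

/-- The label of the edge joining a vertex to its parent. -/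
def kestenLabel (ω : List ℕ → VertexData) (u : List ℕ) : ℝ := (ω u).2.2

open Classical in
/-- The shape of Kesten's tree with i.i.d. uniform edge labels. On the null event that two labels
coincide, it is given an arbitrary value. -/
def kestenShape (ω : List ℕ → VertexData) : ETree :=
  if h : (kestenTree ω).DistinctLabels (kestenLabel ω) then
    (kestenTree ω).shape (kestenLabel ω) h
  else ETree.mk PointedETree.single

end

/-!
The convergence is proved by counting. Naming every vertex other than the pointed one by the label
of the edge that joins it to its parent turns pointed edge-labelled trees with `n + 1` vertices into
Cayley trees on `{0, …, n}` rooted at `0`. Conversely, the product of the transpositions of a Cayley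
tree, in any order, is a cycle through all vertices, since every factor merges two cycles
(`CayleyTree.exists_conj_edgeProd`); renaming the vertices in its cyclic order gives a minimal
factorization. Hence a uniform minimal factorization is a uniform Cayley tree in disguise
(`MinimalFactorization.exists_bijective_codes`), the edge above the vertex `i` being labelled `i`.

By the portmanteau theorem it is enough to bound the probability of an open set `G` of trees from
below. Whether a tree belongs to `G` can be read off from its ball of some radius `h`: from the
plane tree `t` representing the ball and from its edge labels, which have to belong to an open set
(`labelSet`). For Kesten's tree, the ball is a given plane tree `t` having `m` vertices at height
`h`, with edge labels in an open set `O`, with probability at most `m * ∏ μ (c_u) * vol O`, the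
product being over the vertices of height less than `h` and `c_u` being their numbers of children
(`kestenLaw_ballEvent_le`): the size bias and the choice of the special child cancel along the
spine, and the factor `m` counts the possible ends of the spine.

For a uniform Cayley tree, the edge labels of `t` may be chosen among the points of a grid, which
are at least as dense in `O` as the uniform law (`cubeMeasure_le_liminf`); the rest of the tree is a
forest planted on the `m` vertices at height `h`, and such forests are counted by Cayley's formula
(`ForestMaps.card_mul`), whose asymptotics produce `m * exp (m - card t)` (`tendsto_ballRatio`). The
same ball is represented by several plane trees. The weight `1 / ∏ c_u!` makes up for this
(`sum_inv_orderCount_le_one`): if the vertices are ordered at random, a given planar order is the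
increasing one with at least this probability, and only one planar order is increasing. Together
with the powers of `e` these weights are the product of the Poisson masses. Finally, Fatou's lemma
allows summation over all plane trees `t` (`kestenLaw_iUnion_ballEvent_le_liminf`).
-/

open MeasureTheory ProbabilityTheory Filter Topology

/-! ### Counting rooted forests -/

/-- Rooted forests with vertex set `β ⊕ γ` whose roots are the elements of `γ`, encoded by the map
that sends a vertex of `β` to its parent. Acyclicity is expressed by a rank function which decreases
along the edges between vertices of `β`. -/
def ForestMaps (β γ : Type) : Type :=
  {f : β → β ⊕ γ // ∃ r : β → ℕ, ∀ b b', f b = Sum.inl b' → r b' < r b}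

namespace ForestMaps

instance (β γ : Type) [Finite β] [Finite γ] : Finite (ForestMaps β γ) := Subtype.finite

/-- A vertex of minimal rank has a root as its parent, so that there is no forest without roots. -/
theorem isEmpty_of_isEmpty (β γ : Type) [Finite β] [Nonempty β] [IsEmpty γ] :
    IsEmpty (ForestMaps β γ) := by
  refine ⟨fun ⟨f, r, hr⟩ => ?_⟩
  obtain ⟨b, hb⟩ := Finite.exists_min r
  rcases hfb : f b with b' | c
  · exact absurd (hr b b' hfb) (hb b').not_gt
  · exact isEmptyElim c

open Classical in
/-- A forest is glued from the set `J` of the children of the roots, the parents of the elements of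
`J`, and a forest with set of roots `J` on the non-root vertices. -/
noncomputable def glue {β γ : Type}
    (x : Σ J : Finset β, (J → γ) × ForestMaps {b // b ∉ J} J) : ForestMaps β γ :=
  ⟨fun b => if h : b ∈ x.1 then Sum.inr (x.2.1 ⟨b, h⟩)
    else Sum.inl (Sum.elim Subtype.val Subtype.val (x.2.2.1 ⟨b, h⟩)), by
    obtain ⟨J, g, f, r, hr⟩ := x
    refine ⟨fun b => if h : b ∈ J then 0 else r ⟨b, h⟩ + 1, fun b b' hbb' => ?_⟩
    by_cases h : b ∈ J
    · simp [h] at hbb'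
    · simp only [h, dite_false, Sum.inl.injEq] at hbb' ⊢
      rcases hf : f ⟨b, h⟩ with c | c
      · have := hr _ _ hf
        rw [hf] at hbb'
        subst hbb'
        simp [c.2, this]
      · rw [hf] at hbb'
        subst hbb'
        simp⟩

theorem glue_injective {β γ : Type} : Function.Injective (glue (β := β) (γ := γ)) := by
  rintro ⟨J, g, f, hf⟩ ⟨J', g', f', hf'⟩ h
  have h1 : ∀ b, (glue ⟨J, g, f, hf⟩).1 b = (glue ⟨J', g', f', hf'⟩).1 b := fun b => by rw [h]
  have hJ : J = J' := by
    ext b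
    have := h1 b
    by_cases hb : b ∈ J <;> by_cases hb' : b ∈ J' <;> simp [glue, hb, hb'] at this ⊢
  subst hJ
  have hg : g = g' := by
    funext b
    simpa [glue] using h1 b
  have hff : f = f' := by
    funext b
    have := h1 b
    simp only [glue, b.2, dite_false, Sum.inl.injEq] at this
    rcases hfb : f b with c | c <;> rcases hfb' : f' b with c' | c' <;> rw [hfb, hfb'] at this
    · rw [Subtype.ext this]
    · exact absurd ((show c.1 = c'.1 from this) ▸ c'.2) c.2
    · exact absurd ((show c.1 = c'.1 from this) ▸ c.2) c'.2
    · rw [Subtype.ext this]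
  subst hg hff
  rfl

theorem glue_surjective {β γ : Type} [Finite β] :
    Function.Surjective (glue (β := β) (γ := γ)) := by
  classical
  have := Fintype.ofFinite β
  rintro ⟨f, r, hr⟩
  let J : Finset β := Finset.univ.filter fun b => (f b).isRight
  have hJ : ∀ b, b ∈ J ↔ (f b).isRight := by simp [J]
  let k : β → {b // b ∉ J} ⊕ J := fun b => if h : b ∈ J then Sum.inr ⟨b, h⟩ else Sum.inl ⟨b, h⟩
  have hk : ∀ b, Sum.elim Subtype.val Subtype.val (k b) = b := fun b => by
    by_cases h : b ∈ J <;> simp [k, h]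
  have hkl : ∀ b c, k b = Sum.inl c → b = c.1 := fun b c h => by
    rw [← hk b, h]; rfl
  have hl : ∀ b : {b // b ∉ J}, (f b.1).isLeft := fun b => by
    have := b.2
    rw [hJ] at this
    simpa using this
  refine ⟨⟨J, fun b => (f b.1).getRight ((hJ _).1 b.2),
    fun b => k ((f b.1).getLeft (hl b)), fun b => r b.1, fun b b' hb => ?_⟩, ?_⟩
  · refine hr _ _ ?_
    rw [← hkl _ _ hb, Sum.inl_getLeft]
  · refine Subtype.ext (funext fun b => ?_)
    by_cases h : b ∈ J
    · simp [glue, h]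
    · simp only [glue, h, dite_false, hk, Sum.inl_getLeft]

/-- The generation-by-generation recursion for the number of rooted forests. -/
theorem card_eq_sum (β γ : Type) [Fintype β] [Fintype γ] :
    Nat.card (ForestMaps β γ) = ∑ J : Finset β,
      Fintype.card γ ^ J.card * Nat.card (ForestMaps {b // b ∉ J} J) := by
  rw [← Nat.card_congr (Equiv.ofBijective _ ⟨glue_injective, glue_surjective (γ := γ)⟩),
    Nat.card_sigma]
  refine Finset.sum_congr rfl fun J _ => ?_
  rw [Nat.card_prod, Nat.card_fun]
  simp

theorem sum_choose_mul (M m : ℕ) :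
    ∑ j ∈ Finset.range (M + 2), (M + 1).choose j * (m ^ j * (j * (M + 1) ^ (M + 1 - j))) =
      (M + 1) * (m * (m + (M + 1)) ^ M) := by
  rw [Finset.sum_range_succ', add_pow m (M + 1) M, Finset.mul_sum, Finset.mul_sum]
  simp only [zero_mul, mul_zero]
  rw [add_zero]
  refine Finset.sum_congr rfl fun j _ => ?_
  have := Nat.add_one_mul_choose_eq M j
  rw [Nat.add_sub_add_right]
  calc _ = (M + 1).choose (j + 1) * (j + 1) * (m ^ (j + 1) * (M + 1) ^ (M - j)) := by ring
    _ = _ := by rw [← this, Nat.cast_id]; ring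

/-- Cayley's formula for rooted forests. The factor `card β + card γ` on the left avoids the
exponent `card β - 1`. -/
theorem card_mul (β γ : Type) [Fintype β] [Fintype γ] :
    Nat.card (ForestMaps β γ) * (Fintype.card β + Fintype.card γ) =
      Fintype.card γ * (Fintype.card β + Fintype.card γ) ^ Fintype.card β := by
  classical
  induction hM : Fintype.card β using Nat.strong_induction_on generalizing β γ with
  | _ M ih =>
    rcases M with _ | M
    · have := Fintype.card_eq_zero_iff.1 hM
      have : Nat.card (ForestMaps β γ) = 1 := by
        refine Nat.card_eq_one_iff_unique.2
          ⟨⟨fun a b => Subtype.ext (funext fun x => isEmptyElim x)⟩,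
            ⟨⟨fun x => isEmptyElim x, fun _ => 0, fun x => isEmptyElim x⟩⟩⟩
      simp [this]
    · have hJ : ∀ J : Finset β, Nat.card (ForestMaps {b // b ∉ J} J) * (M + 1) =
          J.card * (M + 1) ^ (M + 1 - J.card) := by
        intro J
        have hle : J.card ≤ M + 1 := hM ▸ J.card_le_univ
        have hc : Fintype.card {b // b ∉ J} = M + 1 - J.card := by
          rw [Fintype.card_subtype_compl, Fintype.card_coe, hM]
        rcases J.eq_empty_or_nonempty with rfl | hne
        · have : Nonempty {b // b ∉ (∅ : Finset β)} := by
            rw [← Fintype.card_pos_iff, hc]; simp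
          have := isEmpty_of_isEmpty {b // b ∉ (∅ : Finset β)} (∅ : Finset β)
          rw [Nat.card_of_isEmpty, Finset.card_empty, zero_mul, zero_mul]
        · have hpos := hne.card_pos
          have := ih (M + 1 - J.card) (by omega) {b // b ∉ J} J hc
          rwa [Fintype.card_coe, Nat.sub_add_cancel hle] at this
      have hs : Nat.card (ForestMaps β γ) * (M + 1) =
          (M + 1) * (Fintype.card γ * (Fintype.card γ + (M + 1)) ^ M) := by
        rw [← sum_choose_mul, card_eq_sum, Finset.sum_mul]
        simp only [mul_assoc, hJ]
        have := Finset.sum_powerset_apply_card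
          (fun j => Fintype.card γ ^ j * (j * (M + 1) ^ (M + 1 - j)))
          (x := (Finset.univ : Finset β))
        rw [Finset.powerset_univ, Finset.card_univ, hM] at this
        simpa using this
      have : Nat.card (ForestMaps β γ) = Fintype.card γ * (Fintype.card γ + (M + 1)) ^ M :=
        Nat.eq_of_mul_eq_mul_right M.succ_pos (by rw [hs, mul_comm])
      rw [this]
      ring

end ForestMaps

/-! ### Products of transpositions along the edges of a tree -/

/-- The orbit of `x` under `swap x y * σ` follows its orbit under `σ` until the first return to `x`,
which is replaced by `y`. -/
theorem Equiv.Perm.sameCycle_swap_mul {α : Type*} [Finite α] [DecidableEq α]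
    {σ : Equiv.Perm α} {x y : α}
    (h : ¬ σ.SameCycle x y) : (Equiv.swap x y * σ).SameCycle x y := by
  have hex : ∃ k, (σ ^ (k + 1)) x = x := by
    obtain ⟨k, hk, h1⟩ := (isOfFinOrder_of_finite σ).exists_pow_eq_one
    exact ⟨k - 1, by rw [Nat.sub_add_cancel hk, h1]; rfl⟩
  classical
  let k := Nat.find hex
  have hy : ∀ i : ℕ, (σ ^ i) x ≠ y := fun i hi => h ⟨i, by simpa using hi⟩
  have key : ∀ i ≤ k, ((Equiv.swap x y * σ) ^ i) x = (σ ^ i) x := by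
    intro i
    induction i with
    | zero => simp
    | succ i ih =>
      intro hi
      rw [pow_succ', Equiv.Perm.mul_apply, ih (by omega), Equiv.Perm.mul_apply,
        ← Equiv.Perm.mul_apply σ, ← pow_succ']
      exact Equiv.swap_apply_of_ne_of_ne (Nat.find_min hex (by omega : i < k)) (hy _)
  refine ⟨(k + 1 : ℕ), ?_⟩
  rw [zpow_natCast, pow_succ', Equiv.Perm.mul_apply, key k le_rfl, Equiv.Perm.mul_apply,
    ← Equiv.Perm.mul_apply σ, ← pow_succ', Nat.find_spec hex, Equiv.swap_apply_left]

/-- Multiplying by a transposition of two points in different cycles merges these cycles. -/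
theorem Equiv.Perm.SameCycle.swap_mul {α : Type*} [Finite α] [DecidableEq α]
    {σ : Equiv.Perm α} {x y a b : α}
    (h : ¬ σ.SameCycle x y) (hab : σ.SameCycle a b) : (Equiv.swap x y * σ).SameCycle a b := by
  have hxy := Equiv.Perm.sameCycle_swap_mul h
  have step : ∀ c, (Equiv.swap x y * σ).SameCycle c (σ c) := by
    intro c
    have hc : (Equiv.swap x y * σ).SameCycle c (Equiv.swap x y (σ c)) := ⟨1, by simp⟩
    rcases eq_or_ne (σ c) x with hx | hx
    · rw [hx, Equiv.swap_apply_left] at hc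
      rw [hx]
      exact hc.trans hxy.symm
    · rcases eq_or_ne (σ c) y with hy | hy
      · rw [hy, Equiv.swap_apply_right] at hc
        rw [hy]
        exact hc.trans hxy
      · rwa [Equiv.swap_apply_of_ne_of_ne hx hy] at hc
  obtain ⟨k, -, -, rfl⟩ := hab.exists_pow_eq''
  clear hab
  induction k with
  | zero => exact Equiv.Perm.SameCycle.refl _ _
  | succ k ih =>
    rw [pow_succ', Equiv.Perm.mul_apply]
    exact ih.trans (step _)

theorem conj_prod_reverse_ofFn {n : ℕ} {G : Type*} [Group G] (g : G) (t : Fin n → G) :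
    (List.ofFn fun i => g * t i * g⁻¹).reverse.prod = g * (List.ofFn t).reverse.prod * g⁻¹ := by
  have := map_list_prod (MulAut.conj g) (List.ofFn t).reverse
  rw [List.map_reverse, List.map_ofFn] at this
  simpa [Function.comp_def] using this.symm

/-- Trees with vertex set `{0, …, n}`, rooted at `0`: the vertex `i + 1` has parent `p i`, and
acyclicity is expressed by a rank function that increases from parent to child. -/
def CayleyTree (n : ℕ) : Type :=
  {p : Fin n → Fin (n + 1) // ∃ r : Fin (n + 1) → ℕ, ∀ i, r (p i) < r i.succ}

namespace CayleyTree

variable {n : ℕ}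

instance : Finite (CayleyTree n) := Subtype.finite

theorem card_mul_le : Nat.card (CayleyTree n) * (n + 1) ≤ (n + 1) ^ n := by
  have h := ForestMaps.card_mul (Fin n) Unit
  simp only [Fintype.card_fin, Fintype.card_unit, one_mul] at h
  rw [← h]
  refine Nat.mul_le_mul_right _ ?_
  let e : Fin (n + 1) → Fin n ⊕ Unit := Fin.cases (Sum.inr ()) Sum.inl
  have he : Function.Injective e := by
    intro a b
    refine Fin.cases ?_ (fun a => ?_) a <;> refine Fin.cases ?_ (fun b => ?_) b <;> simp [e]
  refine Nat.card_le_card_of_injective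
    (fun p : CayleyTree n => (⟨fun i => e (p.1 i), ?_⟩ : ForestMaps (Fin n) Unit)) ?_
  · obtain ⟨p, r, hr⟩ := p
    refine ⟨fun i => r i.succ, fun i j hij => ?_⟩
    have : p i = j.succ := he (by simpa [e] using hij)
    simpa [this] using hr i
  · intro p q hpq
    refine Subtype.ext (funext fun i => he ?_)
    exact congrFun (congrArg Subtype.val hpq) i

theorem ne_parent (p : CayleyTree n) (i : Fin n) : i.succ ≠ p.1 i := by
  obtain ⟨r, hr⟩ := p.2
  intro h
  have := hr i
  rw [← h] at this
  exact this.false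

/-- An induction principle: from parent to child. -/
theorem induction (p : CayleyTree n) {P : Fin (n + 1) → Prop} (h0 : P 0)
    (hs : ∀ i, P (p.1 i) → P i.succ) (v : Fin (n + 1)) : P v := by
  obtain ⟨r, hr⟩ := p.2
  induction hv : r v using Nat.strong_induction_on generalizing v with
  | _ m ih =>
    subst hv
    induction v using Fin.cases with
    | zero => exact h0
    | succ i => exact hs i (ih _ (hr i) _ rfl)

/-- The parent of a vertex, with the convention that the root is its own parent. -/
def parent (p : CayleyTree n) : Fin (n + 1) → Fin (n + 1) := Fin.cases 0 p.1

/-- The set of the descendants of `j + 1`, including itself. -/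
def descendants (p : CayleyTree n) (j : Fin n) : Set (Fin (n + 1)) :=
  {v | ∃ k, p.parent^[k] v = j.succ}

theorem parent_notMem_descendants (p : CayleyTree n) (j : Fin n) :
    p.1 j ∉ p.descendants j := by
  obtain ⟨r, hr⟩ := p.2
  rintro ⟨k, hk⟩
  have hle : ∀ v, r (p.parent v) ≤ r v := by
    intro v
    refine Fin.cases ?_ (fun i => ?_) v
    · simp [parent]
    · simpa [parent] using (hr i).le
  have hle' : ∀ k v, r (p.parent^[k] v) ≤ r v := by
    intro k
    induction k with
    | zero => simp
    | succ k ih => exact fun v => (ih _).trans (hle v)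
  have := hle' k (p.1 j)
  rw [hk] at this
  exact (hr j).not_ge this

theorem swap_mem_descendants_iff (p : CayleyTree n) {i j : Fin n} (hij : i ≠ j)
    (v : Fin (n + 1)) :
    Equiv.swap i.succ (p.1 i) v ∈ p.descendants j ↔ v ∈ p.descendants j := by
  have hi : i.succ ∈ p.descendants j ↔ p.1 i ∈ p.descendants j := by
    constructor
    · rintro ⟨k, hk⟩
      cases k with
      | zero => exact absurd (Fin.succ_injective _ hk) hij
      | succ k => exact ⟨k, hk⟩
    · rintro ⟨k, hk⟩
      exact ⟨k + 1, hk⟩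
  rcases eq_or_ne v i.succ with rfl | h1
  · rw [Equiv.swap_apply_left, hi]
  · rcases eq_or_ne v (p.1 i) with rfl | h2
    · rw [Equiv.swap_apply_right, hi]
    · rw [Equiv.swap_apply_of_ne_of_ne h1 h2]

/-- The product of the transpositions associated with the edges above the vertices `i + 1`,
`i ∈ l`. -/
def edgeProd (p : CayleyTree n) (l : List (Fin n)) : Equiv.Perm (Fin (n + 1)) :=
  (l.map fun i => Equiv.swap i.succ (p.1 i)).prod

/-- The edge above `j + 1` is the only one through which the set of descendants of `j + 1` can be
left. -/
theorem not_sameCycle_edgeProd (p : CayleyTree n) {l : List (Fin n)} {j : Fin n} (hj : j ∉ l) :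
    ¬ (p.edgeProd l).SameCycle j.succ (p.1 j) := by
  have h1 : ∀ v, p.edgeProd l v ∈ p.descendants j ↔ v ∈ p.descendants j := by
    induction l with
    | nil => simp [edgeProd]
    | cons i l ih =>
      intro v
      have hij : i ≠ j := fun h => hj (h ▸ List.mem_cons_self)
      rw [← ih (fun h => hj (List.mem_cons_of_mem _ h)) v, ← p.swap_mem_descendants_iff hij]
      simp [edgeProd]
  intro h
  obtain ⟨k, -, -, hk⟩ := h.exists_pow_eq''
  apply p.parent_notMem_descendants j
  rw [← hk]
  clear hk
  induction k with
  | zero => exact ⟨0, rfl⟩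
  | succ k ih => rwa [pow_succ', Equiv.Perm.mul_apply, h1]

theorem sameCycle_edgeProd (p : CayleyTree n) {l : List (Fin n)} (hl : l.Nodup) :
    ∀ i ∈ l, (p.edgeProd l).SameCycle i.succ (p.1 i) := by
  induction l with
  | nil => simp
  | cons j l ih =>
    obtain ⟨hj, hl⟩ := List.nodup_cons.1 hl
    have hns := p.not_sameCycle_edgeProd hj
    have heq : p.edgeProd (j :: l) = Equiv.swap j.succ (p.1 j) * p.edgeProd l := by
      simp [edgeProd]
    intro i hi
    rw [heq]
    rcases List.mem_cons.1 hi with rfl | hi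
    · exact Equiv.Perm.sameCycle_swap_mul hns
    · exact Equiv.Perm.SameCycle.swap_mul hns (ih hl i hi)

theorem sameCycle_edgeProd_zero (p : CayleyTree n) {l : List (Fin n)} (hl : l.Nodup)
    (hall : ∀ i, i ∈ l) (v : Fin (n + 1)) : (p.edgeProd l).SameCycle v 0 :=
  p.induction (P := fun v => (p.edgeProd l).SameCycle v 0) (Equiv.Perm.SameCycle.refl _ _)
    (fun i hi => (p.sameCycle_edgeProd hl i (hall i)).trans hi) v

/-- The product, in any order, of the transpositions associated with the edges of a tree is a
cycle through all vertices. -/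
theorem exists_conj_edgeProd (p : CayleyTree n) {l : List (Fin n)} (hl : l.Nodup)
    (hall : ∀ i, i ∈ l) :
    ∃ ν : Equiv.Perm (Fin (n + 1)), ν 0 = 0 ∧ ν * finRotate (n + 1) * ν⁻¹ = p.edgeProd l := by
  set c := p.edgeProd l with hc
  have hcyc := p.sameCycle_edgeProd_zero hl hall
  rcases n with _ | n
  · exact ⟨1, rfl, Equiv.ext fun v => Subsingleton.elim (α := Fin 1) _ _⟩
  have hmove : ∀ v, c v ≠ v := by
    intro v hv
    have h1 : ∀ w, w = v := fun w => by
      obtain ⟨k, -, -, hk⟩ := ((hcyc v).trans (hcyc w).symm).exists_pow_eq''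
      rw [← hk]
      exact Equiv.Perm.pow_apply_eq_self_of_apply_eq_self hv k
    have := (h1 0).trans (h1 1).symm
    simp at this
  have hcycle : c.IsCycle := ⟨0, hmove 0, fun w _ => (hcyc w).symm⟩
  have hsupp : c.support = Finset.univ := by
    ext v; simp [hmove v]
  have hconj : IsConj (finRotate (n + 2)) c :=
    isCycle_finRotate.isConj hcycle (by rw [hsupp, support_finRotate])
  obtain ⟨ν, hν⟩ := isConj_iff.1 hconj
  obtain ⟨k, -, -, hk⟩ := (hcyc (ν 0)).exists_pow_eq''
  -- The conjugation is corrected by a power of the cycle in order to fix `0`.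
  refine ⟨c ^ k * ν, hk, ?_⟩
  calc c ^ k * ν * finRotate (n + 2) * (c ^ k * ν)⁻¹
      = c ^ k * (ν * finRotate (n + 2) * ν⁻¹) * (c ^ k)⁻¹ := by group
    _ = c := by rw [hν]; group

end CayleyTree

/-! ### Minimal factorizations and Cayley trees -/

theorem SimpleGraph.Connected.exists_adj_dist_lt {V : Type*} {G : SimpleGraph V} (hG : G.Connected)
    (r v : V)
    (hv : v ≠ r) : ∃ w, G.Adj v w ∧ G.dist r w < G.dist r v := by
  obtain ⟨q, hq⟩ := hG.exists_walk_length_eq_dist v r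
  cases q with
  | nil => exact absurd rfl hv
  | @cons _ w _ hvw q =>
    refine ⟨w, hvw, ?_⟩
    have := SimpleGraph.dist_le q
    rw [G.dist_comm (u := r) (v := w), G.dist_comm (u := r) (v := v), ← hq,
      SimpleGraph.Walk.length_cons]
    omega

namespace MinimalFactorization

variable {n : ℕ}

/-- The tree of the factorization `F` becomes `p` when every vertex other than the root gets as its
name the label of the edge that joins it to its parent. -/
def Codes (F : MinimalFactorization (n + 1)) (p : CayleyTree n) : Prop :=
  ∃ ν : Equiv.Perm (Fin (n + 1)), ν 0 = 0 ∧
    ∀ i : Fin n, ν * F.1 i * ν⁻¹ = Equiv.swap i.succ (p.1 i)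

theorem conj_swap (ν : Equiv.Perm (Fin n)) (x y : Fin n) :
    ν * Equiv.swap x y * ν⁻¹ = Equiv.swap (ν x) (ν y) :=
  (Equiv.swap_apply_apply ν x y).symm

/-- The product of the transpositions of the tree is a cycle; the vertices are renamed in its cyclic
order, starting from the root. -/
theorem exists_codes_of_tree (p : CayleyTree n) :
    ∃ F : MinimalFactorization (n + 1), F.Codes p := by
  obtain ⟨ν, h0, hν⟩ := p.exists_conj_edgeProd (l := (List.finRange n).reverse)
    (List.nodup_reverse.2 (List.nodup_finRange n)) (by simp)
  refine ⟨⟨fun i : Fin n => ν⁻¹ * Equiv.swap i.succ (p.1 i) * ν, fun i => ?_, ?_⟩,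
    ν, h0, fun i => by group⟩
  · refine ⟨ν⁻¹ i.succ, ν⁻¹ (p.1 i), fun h => p.ne_parent i (ν⁻¹.injective h), ?_⟩
    rw [← conj_swap, inv_inv]
  · have := conj_prod_reverse_ofFn ν⁻¹ (fun i : Fin n => Equiv.swap i.succ (p.1 i))
    rw [inv_inv] at this
    refine this.trans ?_
    have h2 : (List.ofFn fun i : Fin n => Equiv.swap i.succ (p.1 i)).reverse.prod =
        p.edgeProd (List.finRange n).reverse := by
      rw [CayleyTree.edgeProd, List.map_reverse, List.ofFn_eq_map]
    rw [h2, ← hν]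
    group

/-- The edge from a vertex `v ≠ 0` to a neighbour closer to `0` has a label; this defines an
injection from the vertices other than `0` to the labels, hence a bijection. -/
theorem exists_codes (F : MinimalFactorization (n + 1)) : ∃ p : CayleyTree n, F.Codes p := by
  have h1 : ∀ j : Fin n, ∃ w, F.graph.Adj j.succ w ∧
      F.graph.dist 0 w < F.graph.dist 0 j.succ := fun j =>
    F.connected.exists_adj_dist_lt 0 j.succ (Fin.succ_ne_zero j)
  choose par hadj hdist using h1
  choose hne g hg using hadj
  change Fin n → Fin n at g
  have hginj : Function.Injective g := by
    intro i j hij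
    have h2 := swap_eq_imp (hne i) ((hg i).symm.trans ((congrArg F.1 hij).trans (hg j)))
    rcases Sym2.eq_iff.1 h2 with ⟨h, -⟩ | ⟨h, h'⟩
    · exact Fin.succ_injective _ h
    · have h3 := hdist i
      have h4 := hdist j
      rw [h'] at h3
      rw [← h] at h4
      exact absurd h3 h4.not_gt
  let gE : Equiv.Perm (Fin n) := Equiv.ofBijective g (Finite.injective_iff_bijective.1 hginj)
  let ν₀ : Fin (n + 1) → Fin (n + 1) := Fin.cases 0 fun j => (g j).succ
  have hνinj : Function.Injective ν₀ := by
    intro a b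
    refine Fin.cases ?_ (fun a => ?_) a <;> refine Fin.cases ?_ (fun b => ?_) b
    · simp
    · exact fun h => absurd h.symm (Fin.succ_ne_zero _)
    · exact fun h => absurd h (Fin.succ_ne_zero _)
    · exact fun h => congrArg Fin.succ (hginj (Fin.succ_injective _ h))
  let ν : Equiv.Perm (Fin (n + 1)) :=
    Equiv.ofBijective ν₀ (Finite.injective_iff_bijective.1 hνinj)
  have hνs : ∀ j : Fin n, ν j.succ = (g j).succ := fun j => rfl
  have hg' : ∀ i, g (gE.symm i) = i := fun i => gE.apply_symm_apply i
  refine ⟨⟨fun i => ν (par (gE.symm i)), fun v => F.graph.dist 0 (ν.symm v), fun i => ?_⟩,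
    ν, rfl, fun i => ?_⟩
  · have h2 : i.succ = ν (gE.symm i).succ := by rw [hνs, hg']
    simp only [Equiv.symm_apply_apply]
    rw [h2, Equiv.symm_apply_apply]
    exact hdist _
  · have h2 := hg (gE.symm i)
    have h3 : F.1 i = Equiv.swap (gE.symm i).succ (par (gE.symm i)) := by
      rw [← h2]
      exact congrArg F.1 (hg' i).symm
    rw [h3, conj_swap, hνs, hg']

/-- Two trees coding the same factorization differ by a renaming that fixes the root and respects
the names of the edges; it fixes all vertices, from parent to child. -/
theorem Codes.tree_unique {F : MinimalFactorization (n + 1)} {p q : CayleyTree n}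
    (hp : F.Codes p) (hq : F.Codes q) : p = q := by
  obtain ⟨ν, h0, hν⟩ := hp
  obtain ⟨ν', h0', hν'⟩ := hq
  let π := ν' * ν⁻¹
  have hπ0 : π 0 = 0 := by
    have : ν⁻¹ 0 = 0 := by rw [Equiv.Perm.inv_eq_iff_eq, h0]
    rw [Equiv.Perm.mul_apply, this, h0']
  have hπ : ∀ i : Fin n, Equiv.swap (π i.succ) (π (p.1 i)) = Equiv.swap i.succ (q.1 i) := by
    intro i
    rw [← conj_swap, ← hν, ← hν']
    simp only [π]
    group
  have hfix : ∀ v, π v = v := by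
    refine p.induction hπ0 fun i hi => ?_
    have h1 := hπ i
    rw [hi] at h1
    have h2 : π i.succ ≠ p.1 i := fun h => p.ne_parent i (π.injective (h.trans hi.symm))
    rcases Sym2.eq_iff.1 (swap_eq_imp h2 h1) with ⟨h, -⟩ | ⟨-, h⟩
    · exact h
    · exact absurd h.symm (p.ne_parent i)
  refine Subtype.ext (funext fun i => ?_)
  have h1 := congrArg (fun σ => σ i.succ) (hπ i)
  simpa [hfix] using h1

/-- Two factorizations with the same tree differ by a renaming that fixes `0` and commutes with the
cycle, hence is trivial. -/
theorem Codes.factorization_unique {F F' : MinimalFactorization (n + 1)} {p : CayleyTree n}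
    (h : F.Codes p) (h' : F'.Codes p) : F = F' := by
  obtain ⟨ν, h0, hν⟩ := h
  obtain ⟨ν', h0', hν'⟩ := h'
  have e1 := conj_prod_reverse_ofFn ν F.1
  have e2 := conj_prod_reverse_ofFn ν' F'.1
  have e3 : (fun i : Fin (n + 1 - 1) => ν * F.1 i * ν⁻¹) = fun i => ν' * F'.1 i * ν'⁻¹ :=
    funext fun i => (hν i).trans (hν' i).symm
  rw [e3, e2, F.2.2, F'.2.2] at e1
  let π := ν'⁻¹ * ν
  have hπ : ∀ v, π (finRotate (n + 1) v) = finRotate (n + 1) (π v) := by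
    intro v
    have : π * finRotate (n + 1) = finRotate (n + 1) * π := by
      calc π * finRotate (n + 1) = ν'⁻¹ * (ν * finRotate (n + 1) * ν⁻¹) * ν := by
            simp only [π]; group
        _ = _ := by rw [← e1]; simp only [π]; group
    exact congrArg (fun σ => σ v) this
  have hfix : ∀ v, π v = v := by
    intro v
    induction v using Fin.induction with
    | zero =>
      simp only [π, Equiv.Perm.mul_apply, h0]
      rw [Equiv.Perm.inv_eq_iff_eq, h0']
    | succ i ih =>
      have := hπ i.castSucc
      rwa [ih, finRotate_apply, Fin.coeSucc_eq_succ] at this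
  have hνν : ν' = ν := by
    have : π = 1 := Equiv.ext hfix
    rw [← mul_one ν', ← this]
    simp only [π]
    group
  refine Subtype.ext (funext fun i => ?_)
  have := (hν i).trans (hν' i).symm
  rw [hνν] at this
  exact mul_left_cancel (mul_right_cancel this)

theorem exists_bijective_codes (n : ℕ) :
    ∃ f : MinimalFactorization (n + 1) → CayleyTree n,
      Function.Bijective f ∧ ∀ F : MinimalFactorization (n + 1), F.Codes (f F) := by
  choose f hf using fun F : MinimalFactorization (n + 1) => F.exists_codes
  refine ⟨f, ⟨fun F F' h => (hf F).factorization_unique (h ▸ hf F'), fun p => ?_⟩, hf⟩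
  obtain ⟨F, hF⟩ := exists_codes_of_tree p
  exact ⟨F, (hf F).tree_unique hF⟩

end MinimalFactorization

/-! ### Balls as sets of words -/

/-- `t` is the set of the words of a plane tree of height at most `h`. -/
structure IsPlaneBall (h : ℕ) (t : Finset (List ℕ)) : Prop where
  nil_mem : [] ∈ t
  parent_mem : ∀ i u, i :: u ∈ t → u ∈ t
  length_le : ∀ u ∈ t, u.length ≤ h
  children : ∀ u ∈ t, ∃ k : ℕ, ∀ i, i :: u ∈ t ↔ i < k

/-- The number of children of the word `u` in the set of words `t`. -/
noncomputable def offspring (t : Finset (List ℕ)) (u : List ℕ) : ℕ := sInf {i | i :: u ∉ t}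

theorem IsPlaneBall.cons_mem_iff {h : ℕ} {t : Finset (List ℕ)} (ht : IsPlaneBall h t)
    {u : List ℕ} (hu : u ∈ t) (i : ℕ) : i :: u ∈ t ↔ i < offspring t u := by
  obtain ⟨k, hk⟩ := ht.children u hu
  have : offspring t u = k := by
    have h1 : {i | i :: u ∉ t} = Set.Ici k := by ext i; simp [hk]
    rw [offspring, h1, csInf_Ici]
  rw [this, hk]

/-- `ψ` identifies the set of words `t` with the ball of radius `h` of `B`. -/
structure IsChart (h : ℕ) (t : Finset (List ℕ)) (B : PointedETree) (ψ : List ℕ → B.V) : Prop where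
  injOn : Set.InjOn ψ t
  map_nil : ψ [] = B.root
  adj_parent : ∀ i u, i :: u ∈ t → B.graph.Adj (ψ (i :: u)) (ψ u)
  adj_imp : ∀ u ∈ t, ∀ v ∈ t, B.graph.Adj (ψ u) (ψ v) → (∃ i, v = i :: u) ∨ ∃ i, u = i :: v
  neighbor : ∀ u ∈ t, u.length < h → ∀ w, B.graph.Adj (ψ u) w → ∃ v ∈ t, ψ v = w

namespace IsChart

variable {h : ℕ} {t : Finset (List ℕ)} {A B : PointedETree}

theorem dist_le {ψ : List ℕ → B.V} (hψ : IsChart h t B ψ) (ht : IsPlaneBall h t) {u : List ℕ}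
    (hu : u ∈ t) : B.graph.dist B.root (ψ u) ≤ u.length := by
  induction u with
  | nil => simp [hψ.map_nil]
  | cons i u ih =>
    have h1 := ih (ht.parent_mem i u hu)
    have h2 := B.isTree.connected.dist_triangle (u := B.root) (v := ψ u) (w := ψ (i :: u))
    have h3 := SimpleGraph.dist_eq_one_iff_adj.2 (hψ.adj_parent i u hu).symm
    simp only [List.length_cons]
    omega

theorem exists_word {ψ : List ℕ → B.V} (hψ : IsChart h t B ψ) (ht : IsPlaneBall h t) (d : ℕ)
    (hd : d ≤ h) (w : B.V) (hw : B.graph.dist B.root w ≤ d) :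
    ∃ u ∈ t, u.length ≤ d ∧ ψ u = w := by
  induction d generalizing w with
  | zero =>
    refine ⟨[], ht.nil_mem, le_rfl, ?_⟩
    rw [hψ.map_nil]
    exact (B.isTree.connected.dist_eq_zero_iff).1 (Nat.le_zero.1 hw)
  | succ d ih =>
    rcases eq_or_ne w B.root with rfl | hne
    · exact ⟨[], ht.nil_mem, by simp, hψ.map_nil⟩
    · obtain ⟨w', hadj, hlt⟩ :=
        B.isTree.connected.exists_adj_dist_lt B.root w hne
      obtain ⟨u, hu, hlen, rfl⟩ := ih (by omega) w' (by omega)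
      obtain ⟨v, hv, rfl⟩ := hψ.neighbor u hu (by omega) w hadj.symm
      refine ⟨v, hv, ?_, rfl⟩
      rcases hψ.adj_imp u hu v hv hadj.symm with ⟨i, rfl⟩ | ⟨i, rfl⟩
      · simpa using hlen
      · simp only [List.length_cons] at hlen
        omega

theorem mem_ballSet_iff {ψ : List ℕ → B.V} (hψ : IsChart h t B ψ) (ht : IsPlaneBall h t)
    (w : B.V) : w ∈ B.ballSet h ↔ ∃ u ∈ t, ψ u = w := by
  constructor
  · intro hw
    obtain ⟨u, hu, -, h⟩ := hψ.exists_word ht h le_rfl w hw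
    exact ⟨u, hu, h⟩
  · rintro ⟨u, hu, rfl⟩
    exact (hψ.dist_le ht hu).trans (ht.length_le u hu)

theorem adj_iff {ψ : List ℕ → B.V} (hψ : IsChart h t B ψ) {u v : List ℕ} (hu : u ∈ t)
    (hv : v ∈ t) : B.graph.Adj (ψ u) (ψ v) ↔ (∃ i, v = i :: u) ∨ ∃ i, u = i :: v := by
  refine ⟨hψ.adj_imp u hu v hv, ?_⟩
  rintro (⟨i, rfl⟩ | ⟨i, rfl⟩)
  · exact (hψ.adj_parent i u hv).symm
  · exact hψ.adj_parent i v hu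

/-- The bijection from `t` to the ball of radius `h`. -/
noncomputable def equiv {ψ : List ℕ → B.V} (hψ : IsChart h t B ψ) (ht : IsPlaneBall h t) :
    t ≃ B.ballSet h :=
  Equiv.ofBijective (fun u => ⟨ψ u, (hψ.mem_ballSet_iff ht _).2 ⟨u, u.2, rfl⟩⟩)
    ⟨fun u v huv => Subtype.ext (hψ.injOn u.2 v.2 (congrArg Subtype.val huv)),
      fun w => by
        obtain ⟨u, hu, h⟩ := (hψ.mem_ballSet_iff ht _).1 w.2
        exact ⟨⟨u, hu⟩, Subtype.ext h⟩⟩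

theorem close {ψ : List ℕ → A.V} {φ : List ℕ → B.V} (hψ : IsChart h t A ψ)
    (hφ : IsChart h t B φ) (ht : IsPlaneBall h t) {ε : ℝ}
    (hl : ∀ i u, i :: u ∈ t →
      |B.label s(φ (i :: u), φ u) - A.label s(ψ (i :: u), ψ u)| < ε) : A.Close h ε B := by
  have key : ∀ u : t, ((hψ.equiv ht).symm.trans (hφ.equiv ht)) (hψ.equiv ht u) =
      hφ.equiv ht u := fun u => by simp
  refine ⟨⟨(hψ.equiv ht).symm.trans (hφ.equiv ht), ?_⟩, ?_, ?_⟩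
  · intro x y
    obtain ⟨u, rfl⟩ := (hψ.equiv ht).surjective x
    obtain ⟨v, rfl⟩ := (hψ.equiv ht).surjective y
    rw [key, key]
    exact (hφ.adj_iff u.2 v.2).trans (hψ.adj_iff u.2 v.2).symm
  · have h1 : (⟨A.root, A.root_mem_ballSet h⟩ : A.ballSet h) = hψ.equiv ht ⟨[], ht.nil_mem⟩ :=
      Subtype.ext hψ.map_nil.symm
    rw [h1]
    exact (key _).trans (Subtype.ext hφ.map_nil)
  · intro x y hxy
    obtain ⟨u, rfl⟩ := (hψ.equiv ht).surjective x
    obtain ⟨v, rfl⟩ := (hψ.equiv ht).surjective y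
    have hxy : A.graph.Adj (ψ u) (ψ v) := hxy
    simp only [RelIso.coe_fn_mk, key]
    change |B.label s(φ u, φ v) - A.label s(ψ u, ψ v)| < ε
    obtain ⟨u, hu⟩ := u
    obtain ⟨v, hv⟩ := v
    rcases (hψ.adj_iff hu hv).1 hxy with ⟨i, rfl⟩ | ⟨i, rfl⟩
    · rw [Sym2.eq_swap (a := φ u), Sym2.eq_swap (a := ψ u)]
      exact hl i u hv
    · exact hl i v hu

end IsChart

namespace PointedETree

theorem dist_le_of_ballGraph_iso {A B : PointedETree} {h : ℕ} (φ : A.ballGraph h ≃g B.ballGraph h)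
    (hr : φ ⟨A.root, A.root_mem_ballSet h⟩ = ⟨B.root, B.root_mem_ballSet h⟩) (d : ℕ)
    (v : A.ballSet h) (hv : A.graph.dist A.root v ≤ d) :
    B.graph.dist B.root (φ v) ≤ d := by
  induction d generalizing v with
  | zero =>
    have : A.root = v := (A.isTree.connected.dist_eq_zero_iff).1 (Nat.le_zero.1 hv)
    have : v = ⟨A.root, A.root_mem_ballSet h⟩ := Subtype.ext this.symm
    rw [this, hr]
    simp
  | succ d ih =>
    rcases eq_or_ne (v : A.V) A.root with hv' | hne
    · have : v = ⟨A.root, A.root_mem_ballSet h⟩ := Subtype.ext hv'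
      rw [this, hr]
      simp
    · obtain ⟨w, hadj, hlt⟩ :=
        A.isTree.connected.exists_adj_dist_lt A.root v hne
      have hvh : A.graph.dist A.root v ≤ h := v.2
      let w' : A.ballSet h := ⟨w, hlt.le.trans hvh⟩
      have h1 := ih w' (by simp only [w']; omega)
      have h2 : (A.ballGraph h).Adj w' v := hadj.symm
      have h3 : B.graph.Adj (φ w') (φ v) := φ.map_rel_iff.2 h2
      have h4 := B.isTree.connected.dist_triangle (u := B.root) (v := φ w') (w := φ v)
      rw [SimpleGraph.dist_eq_one_iff_adj.2 h3] at h4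
      omega

theorem Close.mono {A B : PointedETree} {h h' : ℕ} {ε ε' : ℝ} (hAB : A.Close h' ε B)
    (hh : h ≤ h') (hε : ε ≤ ε') : A.Close h ε' B := by
  obtain ⟨φ, hr, hl⟩ := hAB
  have hsubA : A.ballSet h ⊆ A.ballSet h' := fun v hv => le_trans hv hh
  have hsubB : B.ballSet h ⊆ B.ballSet h' := fun v hv => le_trans hv hh
  have hr' : φ.symm ⟨B.root, B.root_mem_ballSet h'⟩ = ⟨A.root, A.root_mem_ballSet h'⟩ := by
    rw [← hr]; exact φ.symm_apply_apply _
  let f : A.ballSet h → B.ballSet h := fun v =>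
    ⟨φ ⟨v, hsubA v.2⟩, dist_le_of_ballGraph_iso φ hr h ⟨v, hsubA v.2⟩ v.2⟩
  let g : B.ballSet h → A.ballSet h := fun v =>
    ⟨φ.symm ⟨v, hsubB v.2⟩, dist_le_of_ballGraph_iso φ.symm hr' h ⟨v, hsubB v.2⟩ v.2⟩
  refine ⟨⟨⟨f, g, fun v => ?_, fun v => ?_⟩, ?_⟩, ?_, ?_⟩
  · refine Subtype.ext ?_
    simp only [f, g, Subtype.coe_eta, RelIso.symm_apply_apply]
  · refine Subtype.ext ?_
    simp only [f, g, Subtype.coe_eta, RelIso.apply_symm_apply]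
  · intro x y
    exact φ.map_rel_iff (a := ⟨x, hsubA x.2⟩) (b := ⟨y, hsubA y.2⟩)
  · have h1 : (φ ⟨A.root, A.root_mem_ballSet h'⟩ : B.V) = B.root := congrArg Subtype.val hr
    exact Subtype.ext h1
  · intro x y hxy
    exact (hl ⟨x, hsubA x.2⟩ ⟨y, hsubA y.2⟩ hxy).trans_le hε

end PointedETree

/-- A neighbourhood of a tree contains all trees that agree with it closely on a large ball. -/
theorem ETree.exists_close_subset {G : Set ETree} (hG : IsOpen G) {A : PointedETree}
    (hA : ETree.mk A ∈ G) :
    ∃ (h₀ : ℕ) (ε : ℝ), 0 < ε ∧ ∀ h ≥ h₀, ∀ B, A.Close h ε B → ETree.mk B ∈ G := by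
  by_contra hcon
  push Not at hcon
  choose h hh B hB hBG using fun n : ℕ => hcon n (1 / ((n : ℝ) + 1)) (by positivity)
  have htend : Tendsto (fun n => ETree.mk (B n)) atTop (𝓝 (ETree.mk A)) := by
    rw [ETree.tendsto_iff_close]
    intro k ε hε
    have h1 := (tendsto_one_div_add_atTop_nhds_zero_nat (𝕜 := ℝ)).eventually (gt_mem_nhds hε)
    filter_upwards [h1, eventually_ge_atTop k] with n hn hkn
    exact ⟨B n, rfl, (hB n).mono (hkn.trans (hh n)) hn.le⟩
  obtain ⟨n, hn⟩ := (htend.eventually (hG.mem_nhds hA)).exists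
  exact hBG n hn

theorem exists_cons_of_mem_erase_nil {t : Finset (List ℕ)} (u : ↥(t.erase [])) :
    ∃ i v, u.1 = i :: v ∧ i :: v ∈ t := by
  obtain ⟨u, hu⟩ := u
  obtain ⟨hne, hu⟩ := Finset.mem_erase.1 hu
  obtain ⟨i, v, rfl⟩ := List.exists_cons_of_ne_nil hne
  exact ⟨i, v, rfl, hu⟩

/-- The labellings `x` of the edges of the plane tree `t` (the edge above the word `u ≠ []` being
labelled `x u`) that force membership in `G`: all trees whose ball of radius `h` is `t` with edge
labels close enough to `x` belong to `G`. -/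
def labelSet (G : Set ETree) (h : ℕ) (t : Finset (List ℕ)) : Set (↥(t.erase []) → ℝ) :=
  {x | ∃ ε > 0, ∀ (B : PointedETree) (ψ : List ℕ → B.V), IsChart h t B ψ →
    (∀ u : ↥(t.erase []), |B.label s(ψ u, ψ u.1.tail) - x u| < ε) → ETree.mk B ∈ G}

theorem isOpen_labelSet (G : Set ETree) (h : ℕ) (t : Finset (List ℕ)) :
    IsOpen (labelSet G h t) := by
  rw [Metric.isOpen_iff]
  rintro x ⟨ε, hε, hx⟩
  refine ⟨ε / 2, by positivity, fun y hy => ⟨ε / 2, by positivity, fun B ψ hψ hB => ?_⟩⟩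
  refine hx B ψ hψ fun u => ?_
  have h1 : |y u - x u| < ε / 2 := (dist_le_pi_dist y x u).trans_lt hy
  have h2 := abs_sub_le (B.label s(ψ u, ψ u.1.tail)) (y u) (x u)
  linarith [hB u]

namespace PlaneTree

theorem finite_ball (τ : PlaneTree) (h : ℕ) : {u | u ∈ τ.carrier ∧ u.length ≤ h}.Finite := by
  induction h with
  | zero =>
    refine (Set.finite_singleton []).subset fun u hu => ?_
    simpa using hu.2
  | succ h ih =>
    choose! k hk using τ.children
    refine ((Set.finite_singleton []).union
      (ih.biUnion fun u _ => (Set.finite_Iio (k u)).image (· :: u))).subset ?_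
    rintro (_ | ⟨i, u⟩) ⟨hu, hlen⟩
    · simp
    · right
      have hu' := τ.parent_mem i u hu
      exact Set.mem_biUnion (x := u) ⟨hu', by simpa using hlen⟩ ⟨i, (hk u hu' i).1 hu, rfl⟩

/-- The set of words of length at most `h` of a plane tree. -/
noncomputable def ball (τ : PlaneTree) (h : ℕ) : Finset (List ℕ) := (τ.finite_ball h).toFinset

theorem mem_ball (τ : PlaneTree) (h : ℕ) (u : List ℕ) :
    u ∈ τ.ball h ↔ u ∈ τ.carrier ∧ u.length ≤ h := by
  simp [ball]

theorem isPlaneBall_ball (τ : PlaneTree) (h : ℕ) : IsPlaneBall h (τ.ball h) where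
  nil_mem := (τ.mem_ball h _).2 ⟨τ.nil_mem, by simp⟩
  parent_mem i u hu := by
    rw [mem_ball] at hu ⊢
    exact ⟨τ.parent_mem i u hu.1, by have := hu.2; simp at this; omega⟩
  length_le u hu := ((τ.mem_ball h u).1 hu).2
  children u hu := by
    rw [mem_ball] at hu
    obtain ⟨k, hk⟩ := τ.children u hu.1
    by_cases hlt : u.length < h
    · refine ⟨k, fun i => ?_⟩
      rw [mem_ball, hk, List.length_cons]
      exact ⟨fun h => h.1, fun h => ⟨h, hlt⟩⟩
    · exact ⟨0, fun i => by rw [mem_ball, List.length_cons]; constructor <;> intro h <;> omega⟩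

/-- The pointed edge-labelled tree of a plane tree with distinct edge labels. -/
abbrev pointed (τ : PlaneTree) (ℓ : List ℕ → ℝ) (hℓ : τ.DistinctLabels ℓ) : PointedETree where
  V := τ.carrier
  graph := τ.graph
  isTree := τ.isTree
  locallyFinite := τ.locallyFinite
  root := ⟨[], τ.nil_mem⟩
  label := τ.edgeLabel ℓ
  label_injOn := τ.edgeLabel_injOn ℓ hℓ

open Classical in
/-- The inclusion of the words of a plane tree into its vertex set. -/
noncomputable def vertex (τ : PlaneTree) (u : List ℕ) : τ.carrier :=
  if h : u ∈ τ.carrier then ⟨u, h⟩ else ⟨[], τ.nil_mem⟩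

theorem coe_vertex (τ : PlaneTree) {u : List ℕ} (hu : u ∈ τ.carrier) :
    (τ.vertex u : List ℕ) = u := by
  simp [vertex, hu]

theorem isChart_vertex (τ : PlaneTree) (ℓ : List ℕ → ℝ) (hℓ : τ.DistinctLabels ℓ) (h : ℕ) :
    IsChart h (τ.ball h) (τ.pointed ℓ hℓ) τ.vertex where
  injOn u hu v hv huv := by
    have h1 := congrArg Subtype.val huv
    rwa [τ.coe_vertex ((τ.mem_ball h u).1 hu).1, τ.coe_vertex ((τ.mem_ball h v).1 hv).1] at h1
  map_nil := by simp [vertex, τ.nil_mem, pointed]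
  adj_parent i u hu := by
    have hu' := ((τ.mem_ball h _).1 hu).1
    refine Or.inr ⟨i, ?_⟩
    rw [τ.coe_vertex hu', τ.coe_vertex (τ.parent_mem i u hu')]
  adj_imp u hu v hv huv := by
    have huv : (∃ i, (τ.vertex v : List ℕ) = i :: (τ.vertex u : List ℕ)) ∨
      ∃ i, (τ.vertex u : List ℕ) = i :: (τ.vertex v : List ℕ) := huv
    rwa [τ.coe_vertex ((τ.mem_ball h u).1 hu).1, τ.coe_vertex ((τ.mem_ball h v).1 hv).1] at huv
  neighbor u hu hlt w hw := by
    have hw : (∃ i, (w : List ℕ) = i :: (τ.vertex u : List ℕ)) ∨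
      ∃ i, (τ.vertex u : List ℕ) = i :: (w : List ℕ) := hw
    rw [τ.coe_vertex ((τ.mem_ball h u).1 hu).1] at hw
    have hwm : (w : List ℕ) ∈ τ.carrier := w.2
    refine ⟨w, (τ.mem_ball h _).2 ⟨hwm, ?_⟩, Subtype.ext (τ.coe_vertex hwm)⟩
    rcases hw with ⟨i, hi⟩ | ⟨i, hi⟩
    · rw [hi, List.length_cons]; omega
    · have := congrArg List.length hi
      rw [List.length_cons] at this
      omega

theorem pointed_label (τ : PlaneTree) (ℓ : List ℕ → ℝ) (hℓ : τ.DistinctLabels ℓ) {i : ℕ}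
    {u : List ℕ} (hu : i :: u ∈ τ.carrier) :
    (τ.pointed ℓ hℓ).label s(τ.vertex (i :: u), τ.vertex u) = ℓ (i :: u) := by
  rw [Sym2.eq_swap]
  have := τ.edgeLabel_cons ℓ (τ.vertex u) (τ.vertex (i :: u)) i (by
    rw [τ.coe_vertex hu, τ.coe_vertex (τ.parent_mem i u hu)])
  rwa [τ.coe_vertex hu] at this

/-- If the shape of a plane tree belongs to an open set, this can be read off from any ball of large
enough radius. -/
theorem eventually_mem_labelSet (τ : PlaneTree) (ℓ : List ℕ → ℝ) (hℓ : τ.DistinctLabels ℓ)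
    {G : Set ETree} (hG : IsOpen G) (hτ : τ.shape ℓ hℓ ∈ G) :
    ∀ᶠ h in atTop, (fun u : ↥((τ.ball h).erase []) => ℓ u) ∈ labelSet G h (τ.ball h) := by
  obtain ⟨h₀, ε, hε, H⟩ := ETree.exists_close_subset hG (A := τ.pointed ℓ hℓ) hτ
  filter_upwards [eventually_ge_atTop h₀] with h hh
  refine ⟨ε, hε, fun B ψ hψ hB => H h hh B ?_⟩
  refine (τ.isChart_vertex ℓ hℓ h).close hψ (τ.isPlaneBall_ball h) fun i u hu => ?_
  rw [τ.pointed_label ℓ hℓ ((τ.mem_ball h _).1 hu).1]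
  exact hB ⟨i :: u, Finset.mem_erase.2 ⟨by simp, hu⟩⟩

theorem shape_mem_of_mem_labelSet (τ : PlaneTree) (ℓ : List ℕ → ℝ) (hℓ : τ.DistinctLabels ℓ)
    {G : Set ETree} {h : ℕ}
    (H : (fun u : ↥((τ.ball h).erase []) => ℓ u) ∈ labelSet G h (τ.ball h)) :
    τ.shape ℓ hℓ ∈ G := by
  obtain ⟨ε, hε, H⟩ := H
  refine H (τ.pointed ℓ hℓ) τ.vertex (τ.isChart_vertex ℓ hℓ h) fun u => ?_
  obtain ⟨i, v, hu, hv⟩ := exists_cons_of_mem_erase_nil u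
  change |_ - ℓ u.1| < ε
  rw [hu, List.tail_cons, τ.pointed_label ℓ hℓ ((τ.mem_ball h _).1 hv).1]
  simpa using hε

end PlaneTree

/-! ### Balls in Cayley trees -/

open Classical in
/-- The vertex of a Cayley tree represented by a word `u` of `t`: the root if `u` is empty, and the
vertex `y u + 1` otherwise. Words outside `t` are sent to the root. -/
noncomputable def node {n : ℕ} (t : Finset (List ℕ)) (y : ↥(t.erase []) → Fin n)
    (u : List ℕ) : Fin (n + 1) :=
  if h : u ∈ t.erase [] then (y ⟨u, h⟩).succ else 0

theorem node_nil {n : ℕ} (t : Finset (List ℕ)) (y : ↥(t.erase []) → Fin n) : node t y [] = 0 := by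
  simp [node]

theorem node_coe {n : ℕ} (t : Finset (List ℕ)) (y : ↥(t.erase []) → Fin n) (u : ↥(t.erase [])) :
    node t y u = (y u).succ := by
  rw [node, dif_pos u.2]

theorem cons_mem_erase {t : Finset (List ℕ)} {i : ℕ} {u : List ℕ} (h : i :: u ∈ t) :
    i :: u ∈ t.erase [] := Finset.mem_erase.2 ⟨List.cons_ne_nil _ _, h⟩

theorem node_cons {n : ℕ} {t : Finset (List ℕ)} (y : ↥(t.erase []) → Fin n) {i : ℕ}
    {u : List ℕ} (h : i :: u ∈ t) : node t y (i :: u) = (y ⟨i :: u, cons_mem_erase h⟩).succ :=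
  node_coe t y ⟨i :: u, cons_mem_erase h⟩

theorem node_injOn {n : ℕ} {t : Finset (List ℕ)} {y : ↥(t.erase []) → Fin n}
    (hy : Function.Injective y) : Set.InjOn (node t y) t := by
  intro u hu v hv huv
  rcases u with _ | ⟨i, u⟩ <;> rcases v with _ | ⟨j, v⟩
  · rfl
  · rw [node_nil, node_cons y hv] at huv
    exact absurd huv.symm (Fin.succ_ne_zero _)
  · rw [node_nil, node_cons y hu] at huv
    exact absurd huv (Fin.succ_ne_zero _)
  · rw [node_cons y hu, node_cons y hv] at huv
    exact congrArg Subtype.val (hy (Fin.succ_injective _ huv))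

/-- The words of the plane tree `t` are identified by `y` with the vertices of the ball of radius
`h` of the Cayley tree `p`. -/
structure IsTreeChart {n : ℕ} (h : ℕ) (p : CayleyTree n) (t : Finset (List ℕ))
    (y : ↥(t.erase []) → Fin n) : Prop where
  plane : IsPlaneBall h t
  injective : Function.Injective y
  parent : ∀ i u (hi : i :: u ∈ t), p.1 (y ⟨i :: u, cons_mem_erase hi⟩) = node t y u
  child : ∀ u ∈ t, u.length < h → ∀ j, p.1 j = node t y u →
    ∃ i, ∃ hi : i :: u ∈ t, y ⟨i :: u, cons_mem_erase hi⟩ = j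

namespace MinimalFactorization

variable {n : ℕ}

/-- The pointed edge-labelled tree of a minimal factorization. -/
abbrev pointed (F : MinimalFactorization (n + 1)) : PointedETree where
  V := Fin (n + 1)
  graph := F.graph
  isTree := F.isTree
  locallyFinite := fun _ => Set.toFinite _
  root := 0
  label := F.label
  label_injOn := F.label_injOn

theorem adj_iff {F : MinimalFactorization (n + 1)} {p : CayleyTree n}
    {ν : Equiv.Perm (Fin (n + 1))} (hν : ∀ i : Fin n, ν * F.1 i * ν⁻¹ = Equiv.swap i.succ (p.1 i))
    (a b : Fin (n + 1)) : F.graph.Adj (ν.symm a) (ν.symm b) ↔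
      ∃ i : Fin n, (a = i.succ ∧ b = p.1 i) ∨ (b = i.succ ∧ a = p.1 i) := by
  have hF : ∀ i : Fin n, F.1 i = Equiv.swap (ν.symm i.succ) (ν.symm (p.1 i)) := by
    intro i
    have := conj_swap ν⁻¹ i.succ (p.1 i)
    rw [← hν, inv_inv] at this
    exact Eq.trans (by group) this
  constructor
  · rintro ⟨hne, i, hi⟩
    refine ⟨i, ?_⟩
    have h2 : s(ν.symm a, ν.symm b) = s(ν.symm i.succ, ν.symm (p.1 i)) :=
      swap_eq_imp hne (hi.symm.trans (hF i))
    rcases Sym2.eq_iff.1 h2 with ⟨h, h'⟩ | ⟨h, h'⟩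
    · exact Or.inl ⟨ν.symm.injective h, ν.symm.injective h'⟩
    · exact Or.inr ⟨ν.symm.injective h', ν.symm.injective h⟩
  · rintro ⟨i, ⟨rfl, rfl⟩ | ⟨rfl, rfl⟩⟩
    · exact ⟨fun h => p.ne_parent i (ν.symm.injective h), i, hF i⟩
    · exact ⟨fun h => p.ne_parent i (ν.symm.injective h.symm), i,
        (hF i).trans (Equiv.swap_comm _ _)⟩

/-- Undoing the renaming turns the ball of the Cayley tree into the ball of the factorization tree;
the edge above the vertex named `i + 1` is labelled `i + 1`. -/
theorem Codes.exists_chart {F : MinimalFactorization (n + 1)} {p : CayleyTree n} (hp : F.Codes p)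
    {h : ℕ} {t : Finset (List ℕ)} {y : ↥(t.erase []) → Fin n} (hy : IsTreeChart h p t y) :
    ∃ ψ : List ℕ → Fin (n + 1), IsChart h t F.pointed ψ ∧
      ∀ u : ↥(t.erase []), F.label s(ψ u, ψ u.1.tail) = (y u : ℝ) + 1 := by
  obtain ⟨ν, h0, hν⟩ := hp
  have hadj := adj_iff hν
  have hpar : ∀ i u, i :: u ∈ t →
      F.graph.Adj (ν.symm (node t y (i :: u))) (ν.symm (node t y u)) := fun i u hu =>
    (hadj _ _).2 ⟨_, Or.inl ⟨node_cons y hu, (hy.parent i u hu).symm⟩⟩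
  have himp : ∀ u ∈ t, ∀ v ∈ t, ∀ j : Fin n, node t y u = j.succ → node t y v = p.1 j →
      ∃ i, u = i :: v := by
    intro u hu v hv j huj hvj
    rcases u with _ | ⟨i, u⟩
    · rw [node_nil] at huj
      exact absurd huj.symm (Fin.succ_ne_zero _)
    · refine ⟨i, ?_⟩
      rw [node_cons y hu] at huj
      rw [← Fin.succ_injective _ huj, hy.parent i u hu] at hvj
      rw [node_injOn hy.injective hv (hy.plane.parent_mem i u hu) hvj]
  refine ⟨fun u => ν.symm (node t y u), ⟨?_, ?_, hpar, ?_, ?_⟩, ?_⟩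
  · exact fun u hu v hv huv => node_injOn hy.injective hu hv (ν.symm.injective huv)
  · change ν.symm (node t y []) = 0
    rw [node_nil, Equiv.symm_apply_eq, h0]
  · intro u hu v hv huv
    obtain ⟨j, ⟨h1, h2⟩ | ⟨h1, h2⟩⟩ := (hadj _ _).1 huv
    · exact Or.inr (himp u hu v hv j h1 h2)
    · exact Or.inl (himp v hv u hu j h1 h2)
  · intro u hu hlt w hw
    obtain ⟨w, rfl⟩ := ν.symm.surjective w
    obtain ⟨j, ⟨h1, h2⟩ | ⟨h1, h2⟩⟩ := (hadj _ _).1 hw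
    · rcases u with _ | ⟨i, u⟩
      · rw [node_nil] at h1
        exact absurd h1.symm (Fin.succ_ne_zero _)
      · refine ⟨u, hy.plane.parent_mem i u hu, ?_⟩
        rw [node_cons y hu] at h1
        rw [h2, ← Fin.succ_injective _ h1, hy.parent i u hu]
    · obtain ⟨i, hi, rfl⟩ := hy.child u hu hlt j h2.symm
      exact ⟨i :: u, hi, by rw [h1, node_cons y hi]⟩
  · intro u
    obtain ⟨i, v, huv, hv⟩ := exists_cons_of_mem_erase_nil u
    obtain rfl : u = ⟨i :: v, cons_mem_erase hv⟩ := Subtype.ext huv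
    refine F.label_eq (i := y ⟨i :: v, cons_mem_erase hv⟩) (hpar i v hv).ne ?_
    rw [node_cons y hv, ← hy.parent i v hv]
    have := conj_swap ν⁻¹ (y ⟨i :: v, cons_mem_erase hv⟩).succ
      (p.1 (y ⟨i :: v, cons_mem_erase hv⟩))
    rw [← hν, inv_inv] at this
    exact Eq.trans (by group) this

theorem Codes.scale_mem {F : MinimalFactorization (n + 1)} {p : CayleyTree n} (hp : F.Codes p)
    {h : ℕ} {t : Finset (List ℕ)} {y : ↥(t.erase []) → Fin n} (hy : IsTreeChart h p t y)
    {G : Set ETree} (hG : (fun u => ((y u : ℝ) + 1) / ((n : ℝ) + 1)) ∈ labelSet G h t)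
    (hpos : 0 < 1 / ((n + 1 : ℕ) : ℝ)) :
    ETree.scale (1 / ((n + 1 : ℕ) : ℝ)) hpos F.toETree ∈ G := by
  obtain ⟨ψ, hψ, hl⟩ := hp.exists_chart hy
  obtain ⟨ε, hε, H⟩ := hG
  refine H (PointedETree.scale (1 / ((n + 1 : ℕ) : ℝ)) hpos F.pointed) ψ
    ⟨hψ.injOn, hψ.map_nil, hψ.adj_parent, hψ.adj_imp, hψ.neighbor⟩ fun u => ?_
  change |1 / ((n + 1 : ℕ) : ℝ) * F.label s(ψ u, ψ u.1.tail) - _| < ε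
  rw [hl]
  have : 1 / ((n + 1 : ℕ) : ℝ) * ((y u : ℝ) + 1) - ((y u : ℝ) + 1) / ((n : ℝ) + 1) = 0 := by
    push_cast; ring
  rw [this, abs_zero]
  exact hε

end MinimalFactorization

/-! ### Planar orders -/

/-- The number of ways to reorder the children of the words of length less than `h`. -/
noncomputable def orderCount (h : ℕ) (t : Finset (List ℕ)) : ℕ :=
  ∏ u ∈ t.filter (fun u => u.length < h), (offspring t u).factorial

theorem orderCount_pos (h : ℕ) (t : Finset (List ℕ)) : 0 < orderCount h t :=
  Finset.prod_pos fun _ _ => Nat.factorial_pos _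

/-- The images under `σ` of siblings are increasing. -/
def IsSorted {n : ℕ} (σ : Equiv.Perm (Fin n)) (t : Finset (List ℕ))
    (y : ↥(t.erase []) → Fin n) : Prop :=
  ∀ u i j (hi : i :: u ∈ t) (hj : j :: u ∈ t), i < j →
    σ (y ⟨i :: u, cons_mem_erase hi⟩) < σ (y ⟨j :: u, cons_mem_erase hj⟩)

/-- Every permutation can be turned into one that is increasing on siblings by permuting siblings,
so that at least a fraction `1 / orderCount h t` of all permutations has this property. -/
theorem factorial_le_card_isSorted {n h : ℕ} {t : Finset (List ℕ)} (ht : IsPlaneBall h t)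
    {y : ↥(t.erase []) → Fin n} (hy : Function.Injective y) :
    n.factorial ≤ Nat.card {σ : Equiv.Perm (Fin n) // IsSorted σ t y} * orderCount h t := by
  let U : Type := ↥(t.filter fun u => u.length < h)
  let _ : Fintype U := Finset.fintypeCoeSort _
  have hU : ∀ u : U, u.1 ∈ t := fun u => (Finset.mem_filter.1 u.2).1
  have hmem : ∀ (u : U) (i : Fin (offspring t u.1)), (i : ℕ) :: u.1 ∈ t := fun u i =>
    (ht.cons_mem_iff (hU u) i).2 i.2
  let e : (Σ u : U, Fin (offspring t u.1)) ↪ Fin n :=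
    ⟨fun x => y ⟨(x.2 : ℕ) :: x.1.1, cons_mem_erase (hmem x.1 x.2)⟩, by
      rintro ⟨⟨u, hu⟩, i⟩ ⟨⟨v, hv⟩, j⟩ h
      have h1 := List.cons.inj (congrArg Subtype.val (hy h))
      obtain ⟨h2, rfl⟩ := h1
      obtain rfl := Fin.ext h2
      rfl⟩
  let ρ : (∀ u : U, Equiv.Perm (Fin (offspring t u.1))) → Equiv.Perm (Fin n) := fun π =>
    (Equiv.Perm.sigmaCongrRight π).viaEmbedding e
  have hρ : ∀ π u i, ρ π (e ⟨u, i⟩) = e ⟨u, π u i⟩ := fun π u i => by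
    simp only [ρ, Equiv.Perm.viaEmbedding_apply]
    rfl
  let Φ : {σ : Equiv.Perm (Fin n) // IsSorted σ t y} ×
      (∀ u : U, Equiv.Perm (Fin (offspring t u.1))) → Equiv.Perm (Fin n) :=
    fun x => x.1.1 * (ρ x.2)⁻¹
  have hΦ : Function.Surjective Φ := by
    intro τ
    let s : ∀ u : U, Equiv.Perm (Fin (offspring t u.1)) := fun u =>
      Tuple.sort fun i => τ (e ⟨u, i⟩)
    -- Sorting the images under `τ` of every group of siblings gives a sorted permutation.
    refine ⟨⟨⟨τ * ρ s, ?_⟩, s⟩, by simp only [Φ]; group⟩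
    intro u i j hi hj hij
    have hut := ht.parent_mem i u hi
    have hlen := ht.length_le _ hi
    rw [List.length_cons] at hlen
    let u' : U := ⟨u, Finset.mem_filter.2 ⟨hut, by omega⟩⟩
    let i' : Fin (offspring t u) := ⟨i, (ht.cons_mem_iff hut i).1 hi⟩
    let j' : Fin (offspring t u) := ⟨j, (ht.cons_mem_iff hut j).1 hj⟩
    have hmono : Monotone fun i => τ (e ⟨u', s u' i⟩) :=
      Tuple.monotone_sort fun i => τ (e ⟨u', i⟩)
    have hinj : Function.Injective fun i => τ (e ⟨u', s u' i⟩) := by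
      intro a b hab
      have h1 := e.injective (τ.injective hab)
      simpa using h1
    have hlt := (hmono.strictMono_of_injective hinj) (show i' < j' from hij)
    have h1 := hρ s u' i'
    have h2 := hρ s u' j'
    change τ (ρ s (e ⟨u', i'⟩)) < τ (ρ s (e ⟨u', j'⟩))
    rw [h1, h2]
    exact hlt
  have hcard := Nat.card_le_card_of_surjective Φ hΦ
  rw [Nat.card_prod, Nat.card_perm, Nat.card_pi, Nat.card_fin] at hcard
  refine hcard.trans (Nat.mul_le_mul_left _ (le_of_eq ?_))
  simp only [Nat.card_perm, Nat.card_fin, U]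
  rw [orderCount]
  exact Finset.prod_coe_sort (t.filter fun u => u.length < h) (fun u => (offspring t u).factorial)

theorem exists_eq_of_strictMono_of_range_eq {α : Type*} [LinearOrder α] {c c' : ℕ} {f : Fin c → α}
    {f' : Fin c' → α} (hf : StrictMono f) (hf' : StrictMono f') (h : Set.range f = Set.range f') :
    ∃ hc : c = c', ∀ i, f i = f' (Fin.cast hc i) := by
  have hc : c = c' := by
    rw [← Nat.card_fin c, ← Nat.card_fin c', ← Nat.card_range_of_injective hf.injective, h,
      Nat.card_range_of_injective hf'.injective]
  subst hc
  exact ⟨rfl, fun i => by rw [(hf.range_inj hf').1 h]; rfl⟩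

theorem IsTreeChart.subset_of_isSorted {n h : ℕ} {p : CayleyTree n} {σ : Equiv.Perm (Fin n)}
    {t t' : Finset (List ℕ)} {y : ↥(t.erase []) → Fin n} {y' : ↥(t'.erase []) → Fin n}
    (hy : IsTreeChart h p t y) (hy' : IsTreeChart h p t' y') (hσ : IsSorted σ t y)
    (hσ' : IsSorted σ t' y') (u : List ℕ) (hu : u ∈ t) : u ∈ t' ∧ node t y u = node t' y' u := by
  induction u with
  | nil => exact ⟨hy'.plane.nil_mem, by rw [node_nil, node_nil]⟩
  | cons i u ih =>
    have hut := hy.plane.parent_mem i u hu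
    have hlen := hy.plane.length_le _ hu
    rw [List.length_cons] at hlen
    obtain ⟨hut', hnode⟩ := ih hut
    have hm : ∀ i : Fin (offspring t u), (i : ℕ) :: u ∈ t := fun i =>
      (hy.plane.cons_mem_iff hut i).2 i.2
    have hm' : ∀ i : Fin (offspring t' u), (i : ℕ) :: u ∈ t' := fun i =>
      (hy'.plane.cons_mem_iff hut' i).2 i.2
    let f : Fin (offspring t u) → Fin n := fun i => σ (y ⟨(i : ℕ) :: u, cons_mem_erase (hm i)⟩)
    let f' : Fin (offspring t' u) → Fin n := fun i =>
      σ (y' ⟨(i : ℕ) :: u, cons_mem_erase (hm' i)⟩)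
    have hf : StrictMono f := fun a b hab => hσ u a b (hm a) (hm b) hab
    have hf' : StrictMono f' := fun a b hab => hσ' u a b (hm' a) (hm' b) hab
    have hr : Set.range f = σ '' {j | p.1 j = node t y u} := by
      ext z
      constructor
      · rintro ⟨i, rfl⟩
        exact ⟨_, hy.parent _ _ (hm i), rfl⟩
      · rintro ⟨j, hj, rfl⟩
        obtain ⟨i, hi, rfl⟩ := hy.child u hut (by omega) j hj
        exact ⟨⟨i, (hy.plane.cons_mem_iff hut i).1 hi⟩, rfl⟩
    have hr' : Set.range f' = σ '' {j | p.1 j = node t' y' u} := by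
      ext z
      constructor
      · rintro ⟨i, rfl⟩
        exact ⟨_, hy'.parent _ _ (hm' i), rfl⟩
      · rintro ⟨j, hj, rfl⟩
        obtain ⟨i, hi, rfl⟩ := hy'.child u hut' (by omega) j hj
        exact ⟨⟨i, (hy'.plane.cons_mem_iff hut' i).1 hi⟩, rfl⟩
    obtain ⟨hc, heq⟩ := exists_eq_of_strictMono_of_range_eq hf hf' (by rw [hr, hr', hnode])
    have hi := (hy.plane.cons_mem_iff hut i).1 hu
    have hu' : i :: u ∈ t' := (hy'.plane.cons_mem_iff hut' i).2 (hc ▸ hi)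
    refine ⟨hu', ?_⟩
    rw [node_cons y hu, node_cons y' hu']
    exact congrArg Fin.succ (σ.injective (heq ⟨i, hi⟩))

/-- Once an order on the vertices is fixed, the ball of a Cayley tree has only one representation by
a plane tree with increasing siblings. -/
theorem IsTreeChart.eq_of_isSorted {n h : ℕ} {p : CayleyTree n} {σ : Equiv.Perm (Fin n)}
    {x x' : Σ t : Finset (List ℕ), (↥(t.erase []) → Fin n)}
    (hy : IsTreeChart h p x.1 x.2) (hy' : IsTreeChart h p x'.1 x'.2) (hσ : IsSorted σ x.1 x.2)
    (hσ' : IsSorted σ x'.1 x'.2) : x = x' := by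
  obtain ⟨t, y⟩ := x
  obtain ⟨t', y'⟩ := x'
  have h1 := hy.subset_of_isSorted hy' hσ hσ'
  obtain rfl : t = t' :=
    Finset.Subset.antisymm (fun u hu => (h1 u hu).1)
      fun u hu => (hy'.subset_of_isSorted hy hσ' hσ u hu).1
  have : y = y' := by
    funext u
    have h2 := (h1 u (Finset.mem_of_mem_erase u.2)).2
    rw [node_coe, node_coe] at h2
    exact Fin.succ_injective _ h2
  rw [this]

/-- The representations of the ball of a Cayley tree by plane trees have total weight at most `1`,
if each of them is given the inverse of the number of planar orders as its weight. -/
theorem sum_inv_orderCount_le_one {n h : ℕ} (p : CayleyTree n)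
    (S : Finset (Σ t : Finset (List ℕ), (↥(t.erase []) → Fin n)))
    (hS : ∀ x ∈ S, IsTreeChart h p x.1 x.2) :
    ∑ x ∈ S, ((orderCount h x.1 : ℝ))⁻¹ ≤ 1 := by
  classical
  have hn : (0 : ℝ) < n.factorial := by exact_mod_cast n.factorial_pos
  have h1 : ∀ x ∈ S, (n.factorial : ℝ) * ((orderCount h x.1 : ℝ))⁻¹ ≤
      ∑ σ : Equiv.Perm (Fin n), if IsSorted σ x.1 x.2 then (1 : ℝ) else 0 := by
    intro x hx
    have h2 := factorial_le_card_isSorted (hS x hx).plane (hS x hx).injective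
    have h3 : (0 : ℝ) < orderCount h x.1 := by exact_mod_cast orderCount_pos h x.1
    rw [← div_eq_mul_inv, div_le_iff₀ h3, Finset.sum_boole, ← Fintype.card_subtype,
      ← Nat.card_eq_fintype_card]
    exact_mod_cast h2
  have h4 : ∀ σ : Equiv.Perm (Fin n),
      ∑ x ∈ S, (if IsSorted σ x.1 x.2 then (1 : ℝ) else 0) ≤ 1 := by
    intro σ
    rw [Finset.sum_boole]
    have : (S.filter fun x => IsSorted σ x.1 x.2).card ≤ 1 := by
      rw [Finset.card_le_one]
      intro a ha b hb
      rw [Finset.mem_filter] at ha hb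
      exact (hS a ha.1).eq_of_isSorted (hS b hb.1) ha.2 hb.2
    exact_mod_cast this
  -- Double counting of the pairs of a representation and a permutation for which it is sorted.
  have h5 : (n.factorial : ℝ) * ∑ x ∈ S, ((orderCount h x.1 : ℝ))⁻¹ ≤ n.factorial := by
    rw [Finset.mul_sum]
    refine (Finset.sum_le_sum h1).trans ?_
    rw [Finset.sum_comm]
    refine (Finset.sum_le_sum fun σ _ => h4 σ).trans (le_of_eq ?_)
    simp [Fintype.card_perm]
  nlinarith

/-! ### Counting the Cayley trees with a given ball -/

section Extension

variable {n h : ℕ} {t : Finset (List ℕ)} {y : ↥(t.erase []) → Fin n}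

open Classical in
/-- The Cayley tree obtained by planting a forest on the vertices at height `h` of the plane tree
`t`: the vertices outside the range of `y` get their parents from the forest. -/
noncomputable def graftParent
    (f : ForestMaps {v : Fin n // v ∉ Set.range y} ↥(t.filter fun u => u.length = h))
    (i : Fin n) : Fin (n + 1) :=
  if hi : i ∈ Set.range y then node t y hi.choose.1.tail
  else Sum.elim (fun b => b.1.succ) (fun u => node t y u.1) (f.1 ⟨i, hi⟩)

theorem graftParent_apply (hy : Function.Injective y)
    (f : ForestMaps {v : Fin n // v ∉ Set.range y} ↥(t.filter fun u => u.length = h))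
    (u : ↥(t.erase [])) : graftParent f (y u) = node t y u.1.tail := by
  have hi : y u ∈ Set.range y := ⟨u, rfl⟩
  rw [graftParent, dif_pos hi, hy hi.choose_spec]

theorem graftParent_of_notMem
    (f : ForestMaps {v : Fin n // v ∉ Set.range y} ↥(t.filter fun u => u.length = h))
    (b : {v : Fin n // v ∉ Set.range y}) :
    graftParent f b = Sum.elim (fun b => b.1.succ) (fun u => node t y u.1) (f.1 b) := by
  rw [graftParent, dif_neg b.2]

theorem succ_ne_node (b : {v : Fin n // v ∉ Set.range y}) (u : List ℕ) :
    b.1.succ ≠ node t y u := by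
  by_cases hu : u ∈ t.erase []
  · rw [node, dif_pos hu]
    exact fun h => b.2 ⟨_, (Fin.succ_injective _ h).symm⟩
  · rw [node, dif_neg hu]
    exact Fin.succ_ne_zero _

open Classical in
theorem exists_rank_graftParent (ht : IsPlaneBall h t) (hy : Function.Injective y)
    (f : ForestMaps {v : Fin n // v ∉ Set.range y} ↥(t.filter fun u => u.length = h)) :
    ∃ r : Fin (n + 1) → ℕ, ∀ i, r (graftParent f i) < r i.succ := by
  obtain ⟨s, hs⟩ := f.2
  let r : Fin (n + 1) → ℕ := Fin.cases 0 fun i =>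
    if hi : i ∈ Set.range y then hi.choose.1.length else h + 1 + s ⟨i, hi⟩
  have hr1 : ∀ u : ↥(t.erase []), r (y u).succ = u.1.length := by
    intro u
    have hi : y u ∈ Set.range y := ⟨u, rfl⟩
    simp only [r, Fin.cases_succ]
    rw [dif_pos hi, hy hi.choose_spec]
  have hr2 : ∀ u ∈ t, r (node t y u) = u.length := by
    intro u hu
    rcases u with _ | ⟨i, u⟩
    · rw [node_nil]; rfl
    · rw [node_cons y hu, hr1]
  have hr3 : ∀ b : {v : Fin n // v ∉ Set.range y}, r b.1.succ = h + 1 + s b := by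
    intro b
    simp only [r, Fin.cases_succ]
    rw [dif_neg b.2]
  refine ⟨r, fun i => ?_⟩
  by_cases hi : i ∈ Set.range y
  · obtain ⟨u, rfl⟩ := hi
    obtain ⟨i, v, huv, hv⟩ := exists_cons_of_mem_erase_nil u
    rw [graftParent_apply hy, hr1, huv, List.tail_cons, hr2 v (ht.parent_mem i v hv)]
    simp
  · have h1 := graftParent_of_notMem f ⟨i, hi⟩
    rw [h1]
    rw [hr3 ⟨i, hi⟩]
    rcases hf : f.1 ⟨i, hi⟩ with b | u
    · rw [Sum.elim_inl, hr3]
      have := hs _ _ hf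
      omega
    · have hu := Finset.mem_filter.1 u.2
      rw [Sum.elim_inr, hr2 u hu.1, hu.2]
      omega

theorem isTreeChart_graft (ht : IsPlaneBall h t) (hy : Function.Injective y)
    (f : ForestMaps {v : Fin n // v ∉ Set.range y} ↥(t.filter fun u => u.length = h)) :
    IsTreeChart h (⟨graftParent f, exists_rank_graftParent ht hy f⟩ : CayleyTree n) t y where
  plane := ht
  injective := hy
  parent i u hi := graftParent_apply hy f ⟨i :: u, cons_mem_erase hi⟩
  child u hu hlt j hj := by
    change graftParent f j = _ at hj
    by_cases hjr : j ∈ Set.range y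
    · obtain ⟨v, rfl⟩ := hjr
      obtain ⟨i, w, hvw, hw⟩ := exists_cons_of_mem_erase_nil v
      obtain rfl : v = ⟨i :: w, cons_mem_erase hw⟩ := Subtype.ext hvw
      rw [graftParent_apply hy] at hj
      obtain rfl := node_injOn hy (ht.parent_mem i w hw) hu hj
      exact ⟨i, hw, rfl⟩
    · exfalso
      have h1 := graftParent_of_notMem f ⟨j, hjr⟩
      rw [hj] at h1
      rcases hf : f.1 ⟨j, hjr⟩ with b | v
      · rw [hf, Sum.elim_inl] at h1
        exact succ_ne_node b u h1.symm
      · rw [hf, Sum.elim_inr] at h1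
        have hv := Finset.mem_filter.1 v.2
        have := node_injOn hy hu hv.1 h1
        rw [this, hv.2] at hlt
        exact hlt.false

theorem card_forestMaps_le (ht : IsPlaneBall h t) (hy : Function.Injective y) :
    Nat.card (ForestMaps {v : Fin n // v ∉ Set.range y} ↥(t.filter fun u => u.length = h)) ≤
      Nat.card {p : CayleyTree n // IsTreeChart h p t y} := by
  refine Nat.card_le_card_of_injective (fun f => ⟨_, isTreeChart_graft ht hy f⟩) ?_
  intro f f' hff
  have h1 : graftParent f = graftParent f' :=
    congrArg (fun p : {p : CayleyTree n // IsTreeChart h p t y} => p.1.1) hff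
  refine Subtype.ext (funext fun b => ?_)
  have h2 := congrFun h1 b.1
  rw [graftParent_of_notMem, graftParent_of_notMem] at h2
  rcases hf : f.1 b with c | u <;> rcases hf' : f'.1 b with c' | u' <;>
    rw [hf, hf'] at h2
  · exact congrArg Sum.inl (Subtype.ext (Fin.succ_injective _ h2))
  · exact absurd h2 (succ_ne_node c u')
  · exact absurd h2.symm (succ_ne_node c' u)
  · exact congrArg Sum.inr (Subtype.ext (node_injOn hy (Finset.mem_filter.1 u.2).1
      (Finset.mem_filter.1 u'.2).1 h2))

end Extension

/-- The number of words of length `h` in `t`. -/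
def topCard (h : ℕ) (t : Finset (List ℕ)) : ℕ := (t.filter fun u => u.length = h).card

/-- The number of rooted forests with `n + 1 - card t` non-root vertices whose roots are the words
of `t` of length `h`, by Cayley's formula. It is meaningful for `card t ≤ n + 1` only. -/
noncomputable def forestCount (h : ℕ) (t : Finset (List ℕ)) (n : ℕ) : ℝ :=
  topCard h t * ((n - (t.erase []).card : ℕ) + topCard h t : ℝ) ^ (n - (t.erase []).card) /
    ((n - (t.erase []).card : ℕ) + topCard h t)

theorem forestCount_le {n h : ℕ} {t : Finset (List ℕ)} {y : ↥(t.erase []) → Fin n}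
    (ht : IsPlaneBall h t) (hy : Function.Injective y) :
    forestCount h t n ≤ Nat.card {p : CayleyTree n // IsTreeChart h p t y} := by
  classical
  have h1 := ForestMaps.card_mul {v : Fin n // v ∉ Set.range y}
    ↥(t.filter fun u => u.length = h)
  have h2 : Fintype.card {v : Fin n // v ∉ Set.range y} = n - (t.erase []).card := by
    have : Fintype.card {v : Fin n // v ∈ Set.range y} = (t.erase []).card := by
      rw [← Fintype.card_coe]
      exact (Fintype.card_congr (Equiv.ofInjective y hy)).symm
    rw [Fintype.card_subtype_compl, this, Fintype.card_fin]
  have h3 := card_forestMaps_le ht hy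
  rw [h2, Fintype.card_coe] at h1
  change _ * (_ + topCard h t) = topCard h t * (_ + topCard h t) ^ _ at h1
  rw [forestCount]
  rcases Nat.eq_zero_or_pos (n - (t.erase []).card + topCard h t) with h0 | hpos
  · have : ((n - (t.erase []).card : ℕ) + topCard h t : ℝ) = 0 := by exact_mod_cast h0
    rw [this, div_zero]
    positivity
  · have hpos' : (0 : ℝ) < (n - (t.erase []).card : ℕ) + topCard h t := by exact_mod_cast hpos
    rw [div_le_iff₀ hpos']
    have h4 : (Nat.card (ForestMaps {v : Fin n // v ∉ Set.range y}
        ↥(t.filter fun u => u.length = h)) : ℝ) * ((n - (t.erase []).card : ℕ) + topCard h t) =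
        topCard h t *
          ((n - (t.erase []).card : ℕ) + topCard h t : ℝ) ^ (n - (t.erase []).card) := by
      exact_mod_cast h1
    rw [← h4]
    gcongr

/-- The labellings by `1 / (n + 1), …, n / (n + 1)` that belong to `O`. -/
def GridPoints {ι : Type} (n : ℕ) (O : Set (ι → ℝ)) : Type :=
  {y : ι → Fin n // (fun u => ((y u : ℝ) + 1) / ((n : ℝ) + 1)) ∈ O}

instance {ι : Type} [Finite ι] (n : ℕ) (O : Set (ι → ℝ)) : Finite (GridPoints n O) :=
  Subtype.finite

/-- Double counting of the pairs of a Cayley tree and a representation of its ball by a plane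
tree. -/
theorem sum_forestCount_mul_le {n h : ℕ} (T : Finset (Finset (List ℕ)))
    (hT : ∀ t ∈ T, IsPlaneBall h t) (O : ∀ t : Finset (List ℕ), Set (↥(t.erase []) → ℝ))
    (hO : ∀ t, ∀ x ∈ O t, Function.Injective x) (Q : Set (CayleyTree n))
    (hQ : ∀ (p : CayleyTree n) (t : Finset (List ℕ)) (y : ↥(t.erase []) → Fin n),
      IsTreeChart h p t y → (fun u => ((y u : ℝ) + 1) / ((n : ℝ) + 1)) ∈ O t → p ∈ Q) :
    ∑ t ∈ T, (orderCount h t : ℝ)⁻¹ * forestCount h t n * Nat.card (GridPoints n (O t)) ≤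
      Nat.card Q := by
  classical
  have := Fintype.ofFinite (CayleyTree n)
  let lab : ∀ t : Finset (List ℕ), (↥(t.erase []) → Fin n) → (↥(t.erase []) → ℝ) :=
    fun t y u => ((y u : ℝ) + 1) / ((n : ℝ) + 1)
  have hinj : ∀ (t : Finset (List ℕ)) (y : ↥(t.erase []) → Fin n), lab t y ∈ O t →
      Function.Injective y := by
    intro t y hy u v huv
    refine hO t _ hy ?_
    simp only [lab, huv]
  have h1 : ∀ p : CayleyTree n,
      ∑ t ∈ T, ∑ y : ↥(t.erase []) → Fin n,
        (if IsTreeChart h p t y ∧ lab t y ∈ O t then (orderCount h t : ℝ)⁻¹ else 0) ≤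
      if p ∈ Q then 1 else 0 := by
    intro p
    split_ifs with hp
    · let S := (T.sigma fun t => (Finset.univ : Finset (↥(t.erase []) → Fin n))).filter
        fun x => IsTreeChart h p x.1 x.2 ∧ lab x.1 x.2 ∈ O x.1
      have h2 := sum_inv_orderCount_le_one p S fun x hx => (Finset.mem_filter.1 hx).2.1
      rw [Finset.sum_filter, Finset.sum_sigma] at h2
      exact h2
    · refine (Finset.sum_eq_zero fun t _ => Finset.sum_eq_zero fun y _ => ?_).le
      rw [if_neg]
      exact fun hy => hp (hQ p t y hy.1 hy.2)
  have h2 := Finset.sum_le_sum fun p (_ : p ∈ (Finset.univ : Finset (CayleyTree n))) => h1 p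
  rw [Finset.sum_boole, ← Fintype.card_subtype, ← Nat.card_eq_fintype_card] at h2
  refine le_trans ?_ h2
  rw [Finset.sum_comm]
  refine Finset.sum_le_sum fun t ht => ?_
  rw [Finset.sum_comm]
  have h3 : (Nat.card (GridPoints n (O t)) : ℝ) =
      ∑ y : ↥(t.erase []) → Fin n, if lab t y ∈ O t then 1 else 0 := by
    rw [Finset.sum_boole, ← Fintype.card_subtype, ← Nat.card_eq_fintype_card]
    rfl
  rw [h3, Finset.mul_sum]
  refine Finset.sum_le_sum fun y _ => ?_
  by_cases hy : lab t y ∈ O t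
  · simp only [hy, and_true, if_true, mul_one]
    rw [← Finset.sum_filter, Finset.sum_const, nsmul_eq_mul, ← Fintype.card_subtype,
      ← Nat.card_eq_fintype_card, mul_comm]
    exact mul_le_mul_of_nonneg_right (forestCount_le (hT t ht) (hinj t y hy)) (by positivity)
  · simp [hy]

/-! ### Asymptotics -/

/-- The number of Cayley trees whose ball of radius `h` is represented by `t` through a given
injective labelling of the words `u ≠ []`, divided by the number `(n + 1) ^ (n - 1)` of all Cayley
trees and multiplied by the number of labellings. -/
noncomputable def ballRatio (h : ℕ) (t : Finset (List ℕ)) (n : ℕ) : ℝ :=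
  forestCount h t n * (n : ℝ) ^ (t.erase []).card * ((n : ℝ) + 1) / ((n : ℝ) + 1) ^ n

/-- With `m = topCard h t` and `l` edges in `t`, the main factor is
`((j + m) / (j + l + 1)) ^ j`, where `j = n - l`; it converges to `exp (m - (l + 1))`. -/
theorem tendsto_ballRatio (h : ℕ) (t : Finset (List ℕ)) :
    Tendsto (ballRatio h t) atTop
      (𝓝 (topCard h t * Real.exp (topCard h t - ((t.erase []).card + 1)))) := by
  set m := topCard h t with hm
  set l := (t.erase []).card with hl
  have hinv : ∀ a b : ℝ, Tendsto (fun j : ℕ => ((j : ℝ) + a) / ((j : ℝ) + b)) atTop (𝓝 1) := by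
    intro a b
    have h1 : ∀ a : ℝ, Tendsto (fun j : ℕ => 1 + a / (j : ℝ)) atTop (𝓝 1) := fun a => by
      simpa using (tendsto_const_div_atTop_nhds_zero_nat a).const_add 1
    have h2 := (h1 a).div (h1 b) one_ne_zero
    rw [div_one] at h2
    refine h2.congr' ?_
    filter_upwards [eventually_gt_atTop 0] with j hj
    have hj' : (j : ℝ) ≠ 0 := by positivity
    have e1 : ∀ a : ℝ, 1 + a / (j : ℝ) = (j + a) / j := fun a => by field_simp
    simp only [Pi.div_apply]
    rw [e1, e1, div_div_div_cancel_right₀ hj']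
  have hexp := (Real.tendsto_one_add_div_pow_exp m).div
    (Real.tendsto_one_add_div_pow_exp (l + 1)) (Real.exp_ne_zero _)
  rw [← Real.exp_sub] at hexp
  have hlim := ((hexp.mul ((hinv l (l + 1)).pow l)).mul (hinv (l + 1) m)).const_mul (m : ℝ)
  rw [one_pow, mul_one, mul_one] at hlim
  rw [← tendsto_add_atTop_iff_nat l]
  refine hlim.congr' ?_
  filter_upwards [eventually_gt_atTop 0] with j hj
  have hj' : (0 : ℝ) < j := by exact_mod_cast hj
  have e1 : ∀ a : ℝ, 1 + a / (j : ℝ) = (j + a) / j := fun a => by field_simp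
  simp only [Pi.div_apply]
  rw [ballRatio, forestCount, ← hm, ← hl, Nat.add_sub_cancel, e1, e1, div_pow, div_pow, div_pow,
    div_div_div_cancel_right₀ (by positivity)]
  push_cast
  rw [← add_assoc, pow_add _ j l]
  field_simp

/-- Fatou's lemma for sets. -/
theorem measure_le_liminf_of_eventually_mem {α : Type*} [MeasurableSpace α] {μ : Measure α}
    {A : Set α} {E : ℕ → Set α} (hA : MeasurableSet A) (hE : ∀ n, MeasurableSet (E n))
    (h : ∀ x ∈ A, ∀ᶠ n in atTop, x ∈ E n) : μ A ≤ liminf (fun n => μ (E n)) atTop := by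
  have h1 := lintegral_liminf_le (μ := μ) (u := atTop)
    (f := fun n => (E n).indicator (1 : α → ENNReal)) fun n => measurable_one.indicator (hE n)
  simp only [lintegral_indicator_one (hE _)] at h1
  refine le_trans ?_ h1
  rw [← lintegral_indicator_one hA]
  refine lintegral_mono fun x => ?_
  by_cases hx : x ∈ A
  · rw [Set.indicator_of_mem hx]
    refine le_liminf_of_le (by isBoundedDefault) ?_
    filter_upwards [h x hx] with n hn
    rw [Set.indicator_of_mem hn]
  · rw [Set.indicator_of_notMem hx]
    exact zero_le

/-- Fatou's lemma for series. -/
theorem tsum_liminf_le {α : Type*} (f : ℕ → α → ENNReal) :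
    ∑' a, liminf (fun n => f n a) atTop ≤ liminf (fun n => ∑' a, f n a) atTop := by
  let _ : MeasurableSpace α := ⊤
  have := lintegral_liminf_le (μ := Measure.count) (u := atTop) (f := f)
    fun n => measurable_from_top
  simpa only [lintegral_count] using this

theorem tendsto_grid {x : ℝ} (hx : 0 ≤ x) :
    Tendsto (fun n : ℕ => ((⌊x * n⌋₊ : ℝ) + 1) / ((n : ℝ) + 1)) atTop (𝓝 x) := by
  have h1 := (tendsto_nat_floor_mul_div_atTop hx).comp (tendsto_natCast_atTop_atTop (R := ℝ))
  have h2 := tendsto_natCast_div_add_atTop (1 : ℝ)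
  have h3 := tendsto_one_div_add_atTop_nhds_zero_nat (𝕜 := ℝ)
  have h4 := (h1.mul h2).add h3
  rw [mul_one, add_zero] at h4
  refine h4.congr' ?_
  filter_upwards [eventually_gt_atTop 0] with n hn
  have : (0 : ℝ) < n := by exact_mod_cast hn
  simp only [Function.comp_apply]
  field_simp

/-- The uniform law on the labellings in `[0, 1]`. -/
noncomputable def cubeMeasure (ι : Type) [Fintype ι] : Measure (ι → ℝ) :=
  Measure.pi fun _ => volume.restrict (Set.Icc 0 1)

theorem cubeMeasure_eq (ι : Type) [Fintype ι] :
    cubeMeasure ι = volume.restrict (Set.univ.pi fun _ => Set.Ico 0 1) := by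
  rw [cubeMeasure, volume_pi, Measure.restrict_pi_pi]
  congr 1
  funext _
  exact Measure.restrict_congr_set Ico_ae_eq_Icc.symm

/-- The points of the grid are asymptotically at least as dense in an open set as the uniform law:
the map sending `x` to the corner of the cube of side `1 / n` that contains `x` converges to the
identity. -/
theorem cubeMeasure_le_liminf (ι : Type) [Fintype ι] {O : Set (ι → ℝ)} (hO : IsOpen O) :
    cubeMeasure ι O ≤ liminf (fun n : ℕ => (Nat.card (GridPoints n O) : ENNReal) *
      ENNReal.ofReal ((n : ℝ)⁻¹ ^ Fintype.card ι)) atTop := by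
  classical
  let C : Set (ι → ℝ) := Set.univ.pi fun _ => Set.Ico 0 1
  have hC : MeasurableSet C := MeasurableSet.univ_pi fun _ => measurableSet_Ico
  let E : ℕ → Set (ι → ℝ) := fun n =>
    {x | (fun u => ((⌊x u * n⌋₊ : ℝ) + 1) / ((n : ℝ) + 1)) ∈ O}
  have hE : ∀ n, MeasurableSet (E n) := by
    intro n
    have : Measurable fun (x : ι → ℝ) u => ((⌊x u * n⌋₊ : ℝ) + 1) / ((n : ℝ) + 1) := by
      refine measurable_pi_lambda _ fun u => ?_
      have h1 : Measurable fun x : ι → ℝ => x u * n := (measurable_pi_apply u).mul_const _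
      exact ((measurable_from_top.comp (Nat.measurable_floor.comp h1)).add_const 1).div_const _
    exact this hO.measurableSet
  have h1 : cubeMeasure ι O ≤ liminf (fun n => volume (E n ∩ C)) atTop := by
    rw [cubeMeasure_eq, Measure.restrict_apply hO.measurableSet]
    refine measure_le_liminf_of_eventually_mem (hO.measurableSet.inter hC)
      (fun n => (hE n).inter hC) ?_
    rintro x ⟨hxO, hxC⟩
    have h2 : Tendsto (fun (n : ℕ) u => ((⌊x u * n⌋₊ : ℝ) + 1) / ((n : ℝ) + 1)) atTop (𝓝 x) :=
      tendsto_pi_nhds.2 fun u => tendsto_grid (hxC u trivial).1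
    filter_upwards [h2.eventually (hO.mem_nhds hxO)] with n hn
    exact ⟨hn, hxC⟩
  refine h1.trans (liminf_le_liminf ?_)
  filter_upwards [eventually_gt_atTop 0] with n hn
  have hn' : (0 : ℝ) < n := by exact_mod_cast hn
  have hcover : E n ∩ C ⊆ ⋃ y : GridPoints n O,
      Set.univ.pi fun u => Set.Ico ((y.1 u : ℝ) / n) (((y.1 u : ℝ) + 1) / n) := by
    rintro x ⟨hxE, hxC⟩
    have hlt : ∀ u, ⌊x u * n⌋₊ < n := by
      intro u
      rw [Nat.floor_lt (mul_nonneg (hxC u trivial).1 hn'.le)]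
      have := (hxC u trivial).2
      nlinarith
    refine Set.mem_iUnion.2 ⟨⟨fun u => ⟨⌊x u * n⌋₊, hlt u⟩, hxE⟩, fun u _ => ?_⟩
    have h3 := Nat.floor_le (mul_nonneg (hxC u trivial).1 hn'.le)
    have h4 := Nat.lt_floor_add_one (x u * n)
    exact ⟨(div_le_iff₀ hn').2 h3, (lt_div_iff₀ hn').2 h4⟩
  have := Fintype.ofFinite (GridPoints n O)
  refine (measure_mono hcover).trans ((measure_iUnion_fintype_le _ _).trans (le_of_eq ?_))
  simp only [Real.volume_pi_Ico]
  have h5 : ∀ k : ℝ, (k + 1) / n - k / n = (n : ℝ)⁻¹ := fun k => by field_simp; ring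
  simp only [h5, Finset.prod_const, Finset.sum_const, Finset.card_univ, nsmul_eq_mul,
    Nat.card_eq_fintype_card]
  rw [ENNReal.ofReal_pow (by positivity)]

/-! ### Balls of Kesten's tree -/

theorem spineLaw_apply {S : Set (ℕ × ℕ)} (μ : Measure ℕ) :
    spineLaw μ S = ∫⁻ k : ℕ, (k : ENNReal) * uniformOn (Set.Iio k) {j | (k, j) ∈ S} ∂μ := by
  rw [spineLaw, sizeBiased, Measure.bind_apply (MeasurableSet.of_discrete)
      (measurable_of_countable _).aemeasurable,
    lintegral_withDensity_eq_lintegral_mul _ (measurable_of_countable _)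
      (measurable_of_countable _)]
  refine lintegral_congr fun k => ?_
  rw [Pi.mul_apply, Measure.map_apply (measurable_of_countable _) MeasurableSet.of_discrete]
  rfl

/-- The size bias compensates the choice of the special child. -/
theorem spineLaw_singleton (μ : Measure ℕ) {c j : ℕ} (hj : j < c) :
    spineLaw μ {(c, j)} = μ {c} := by
  have h1 : ∀ k : ℕ, (k : ENNReal) *
      uniformOn (Set.Iio k) {j' | (k, j') ∈ ({(c, j)} : Set (ℕ × ℕ))} =
      ({c} : Set ℕ).indicator 1 k := by
    intro k
    by_cases hk : k = c
    · subst hk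
      have h2 : {j' | (k, j') ∈ ({(k, j)} : Set (ℕ × ℕ))} = {j} := by ext; simp
      have h3 : uniformOn (Set.Iio k) {j} = (k : ENNReal)⁻¹ := by
        have h4 := uniformOn_apply_finset (s := Finset.Iio k) (t := {j})
        rw [Finset.inter_singleton_of_mem (Finset.mem_Iio.2 hj)] at h4
        simpa using h4
      rw [h2, h3, Set.indicator_of_mem (Set.mem_singleton k), Pi.one_apply]
      exact ENNReal.mul_inv_cancel (by exact_mod_cast (by omega : k ≠ 0)) (ENNReal.natCast_ne_top k)
    · have h2 : {j' | (k, j') ∈ ({(c, j)} : Set (ℕ × ℕ))} = ∅ := by ext; simp [hk]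
      rw [h2, measure_empty, mul_zero, Set.indicator_of_notMem (by simpa using hk)]
  rw [spineLaw_apply]
  simp only [h1]
  exact lintegral_indicator_one (measurableSet_singleton c)

theorem ae_spineLaw_lt (μ : Measure ℕ) : ∀ᵐ z ∂spineLaw μ, z.2 < z.1 := by
  rw [ae_iff, spineLaw_apply]
  have h1 : ∀ k : ℕ, (k : ENNReal) *
      uniformOn (Set.Iio k) {j | (k, j) ∈ {z : ℕ × ℕ | ¬ z.2 < z.1}} = 0 := by
    intro k
    rw [(uniformOn_eq_zero_iff (Set.finite_Iio k)).2, mul_zero]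
    ext j
    simp
  simp only [h1, lintegral_zero]

theorem vertexLaw_prod (A : Set ℕ) (B : Set (ℕ × ℕ)) (I : Set ℝ) :
    vertexLaw (A ×ˢ (B ×ˢ I)) = poissonMeasure 1 A *
      (spineLaw (poissonMeasure 1) B * volume.restrict (Set.Icc 0 1) I) := by
  rw [vertexLaw, Measure.prod_prod, Measure.prod_prod]

theorem kestenLaw_map_eval (u : List ℕ) : kestenLaw.map (fun ω => ω u) = vertexLaw :=
  Measure.infinitePi_map_eval _ u

theorem ae_specialChild_lt : ∀ᵐ ω ∂kestenLaw, ∀ u, (ω u).2.1.2 < (ω u).2.1.1 := by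
  rw [ae_all_iff]
  intro u
  have h1 : ∀ᵐ z ∂vertexLaw, z.2.1.2 < z.2.1.1 := by
    have h2 := ae_spineLaw_lt (poissonMeasure 1)
    have h3 : Measure.QuasiMeasurePreserving (fun z : VertexData => z.2.1) vertexLaw
        (spineLaw (poissonMeasure 1)) :=
      Measure.quasiMeasurePreserving_fst.comp Measure.quasiMeasurePreserving_snd
    exact h3.ae h2
  rw [← kestenLaw_map_eval u] at h1
  exact ae_of_ae_map (measurable_pi_apply u).aemeasurable h1

theorem ae_kestenLabel_ne : ∀ᵐ ω ∂kestenLaw, ∀ u v, u ≠ v → kestenLabel ω u ≠ kestenLabel ω v := by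
  rw [ae_all_iff]
  intro u
  rw [ae_all_iff]
  intro v
  by_cases huv : u = v
  · simp [huv]
  have h0 : kestenLaw.map (fun ω => (ω u, ω v)) = vertexLaw.prod vertexLaw :=
    Measure.infinitePi_map_eval_prod huv
  have hlab : vertexLaw.map (fun z => z.2.2) = volume.restrict (Set.Icc (0 : ℝ) 1) := by
    have h1 : (fun z : VertexData => z.2.2) = Prod.snd ∘ Prod.snd := rfl
    rw [h1, ← Measure.map_map measurable_snd measurable_snd, vertexLaw]
    simp
  have h1 : (kestenLaw.map fun ω => (kestenLabel ω u, kestenLabel ω v)) =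
      (volume.restrict (Set.Icc (0 : ℝ) 1)).prod (volume.restrict (Set.Icc (0 : ℝ) 1)) := by
    have h2 : (fun ω : List ℕ → VertexData => (kestenLabel ω u, kestenLabel ω v)) =
        Prod.map (fun z : VertexData => z.2.2) (fun z : VertexData => z.2.2) ∘
          fun ω => (ω u, ω v) := rfl
    rw [h2, ← Measure.map_map (by fun_prop) (by fun_prop), h0,
      ← Measure.map_prod_map _ _ (by fun_prop) (by fun_prop), hlab]
  have hmeas : MeasurableSet {z : ℝ × ℝ | z.1 = z.2} :=
    measurableSet_eq_fun measurable_fst measurable_snd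
  have h2 : ∀ᵐ z ∂(kestenLaw.map fun ω => (kestenLabel ω u, kestenLabel ω v)), z.1 ≠ z.2 := by
    rw [h1, ae_iff]
    have : {z : ℝ × ℝ | ¬ z.1 ≠ z.2} = {z | z.1 = z.2} := by ext; simp
    rw [this, Measure.measure_prod_null hmeas]
    refine Eventually.of_forall fun x => ?_
    have h3 : Prod.mk x ⁻¹' {z : ℝ × ℝ | z.1 = z.2} = {x} := by ext y; simp [eq_comm]
    change volume.restrict (Set.Icc 0 1) (Prod.mk x ⁻¹' {z : ℝ × ℝ | z.1 = z.2}) = 0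
    rw [h3]
    simp
  have hm : Measurable fun ω : List ℕ → VertexData => (kestenLabel ω u, kestenLabel ω v) := by
    unfold kestenLabel
    fun_prop
  filter_upwards [ae_of_ae_map hm.aemeasurable h2] with ω hω _
  exact hω

theorem measurableSet_isSpecial (u : List ℕ) : MeasurableSet {ω | IsSpecial ω u} := by
  induction u with
  | nil => exact MeasurableSet.univ
  | cons i u ih =>
    have h1 : Measurable fun ω : List ℕ → VertexData => (ω u).2.1.2 := by fun_prop
    exact ih.inter (measurableSet_eq_fun measurable_const h1)

theorem measurable_kestenOffspring (u : List ℕ) : Measurable fun ω => kestenOffspring ω u := by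
  have h1 : Measurable fun ω : List ℕ → VertexData => (ω u).2.1.1 := by fun_prop
  have h2 : Measurable fun ω : List ℕ → VertexData => (ω u).1 := by fun_prop
  unfold kestenOffspring
  exact Measurable.ite (measurableSet_isSpecial u) h1 h2

theorem measurableSet_kestenMem (u : List ℕ) : MeasurableSet {ω | KestenMem ω u} := by
  induction u with
  | nil => exact MeasurableSet.univ
  | cons i u ih => exact ih.inter (measurable_kestenOffspring u (measurableSet_Ioi (a := i)))

theorem measurable_kestenLabel (u : List ℕ) : Measurable fun ω => kestenLabel ω u := by
  unfold kestenLabel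
  fun_prop

/-- The event that the ball of radius `h` of Kesten's tree is `t` and that its edge labels belong to
`O`. -/
def ballEvent (h : ℕ) (t : Finset (List ℕ)) (O : Set (↥(t.erase []) → ℝ)) :
    Set (List ℕ → VertexData) :=
  {ω | (kestenTree ω).ball h = t ∧ (fun u : ↥(t.erase []) => kestenLabel ω u) ∈ O}

theorem measurableSet_ballEvent (h : ℕ) (t : Finset (List ℕ)) {O : Set (↥(t.erase []) → ℝ)}
    (hO : MeasurableSet O) : MeasurableSet (ballEvent h t O) := by
  have h1 : MeasurableSet {ω | (kestenTree ω).ball h = t} := by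
    have : {ω | (kestenTree ω).ball h = t} =
        ⋂ u : List ℕ, {ω | (KestenMem ω u ∧ u.length ≤ h) ↔ u ∈ t} := by
      ext ω
      rw [Set.mem_iInter]
      constructor
      · rintro rfl u
        exact ((kestenTree ω).mem_ball h u).symm
      · intro H
        exact Finset.ext fun u => ((kestenTree ω).mem_ball h u).trans (H u)
    rw [this]
    refine MeasurableSet.iInter fun u => ?_
    exact ((measurableSet_kestenMem u).inter (MeasurableSet.const _)).iff (MeasurableSet.const _)
  have h2 : Measurable fun (ω : List ℕ → VertexData) (u : ↥(t.erase [])) => kestenLabel ω u :=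
    measurable_pi_lambda _ fun u => measurable_kestenLabel u
  exact h1.inter (h2 hO)

/-- The special vertex at height `l`. -/
def spine (ω : List ℕ → VertexData) : ℕ → List ℕ
  | 0 => []
  | l + 1 => (ω (spine ω l)).2.1.2 :: spine ω l

theorem length_spine (ω : List ℕ → VertexData) (l : ℕ) : (spine ω l).length = l := by
  induction l with
  | zero => rfl
  | succ l ih => simp [spine, ih]

theorem isSpecial_spine (ω : List ℕ → VertexData) (l : ℕ) : IsSpecial ω (spine ω l) := by
  induction l with
  | zero => trivial
  | succ l ih => exact ⟨ih, rfl⟩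

theorem IsSpecial.eq_spine {ω : List ℕ → VertexData} {u : List ℕ} (hu : IsSpecial ω u) :
    u = spine ω u.length := by
  induction u with
  | nil => rfl
  | cons i u ih =>
    have h1 := ih hu.1
    rw [List.length_cons, spine, ← h1, ← hu.2]

theorem IsSpecial.of_suffix {ω : List ℕ → VertexData} {u v : List ℕ} (hv : IsSpecial ω v)
    (huv : u <:+ v) : IsSpecial ω u := by
  induction v with
  | nil => rwa [List.suffix_nil.1 huv]
  | cons i v ih =>
    rcases List.suffix_cons_iff.1 huv with rfl | h
    · exact hv
    · exact ih hv.1 h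

theorem spine_suffix (ω : List ℕ → VertexData) {l l' : ℕ} (h : l ≤ l') :
    spine ω l <:+ spine ω l' := by
  induction h with
  | refl => exact List.suffix_refl _
  | step _ ih => exact ih.trans (List.suffix_cons _ _)

theorem kestenMem_spine {ω : List ℕ → VertexData} (hω : ∀ u, (ω u).2.1.2 < (ω u).2.1.1) (l : ℕ) :
    KestenMem ω (spine ω l) := by
  induction l with
  | zero => trivial
  | succ l ih =>
    refine ⟨ih, ?_⟩
    rw [kestenOffspring, if_pos (isSpecial_spine ω l)]
    exact hω _

theorem IsPlaneBall.mem_of_suffix {h : ℕ} {t : Finset (List ℕ)} (ht : IsPlaneBall h t)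
    {u v : List ℕ} (hv : v ∈ t) (huv : u <:+ v) : u ∈ t := by
  induction v with
  | nil => rwa [List.suffix_nil.1 huv]
  | cons i v ih =>
    rcases List.suffix_cons_iff.1 huv with rfl | h
    · exact hv
    · exact ih (ht.parent_mem i v hv) h

open Classical in
/-- The set of the data of a vertex `u` for which it is a vertex of `t` with the right number of
children, when the special vertices of height at most `h` are the suffixes of `s`. -/
noncomputable def offspringBox (h : ℕ) (t : Finset (List ℕ)) (s u : List ℕ) :
    Set (ℕ × (ℕ × ℕ)) :=
  if u.length < h then
    if H : ∃ j, j :: u <:+ s then Set.univ ×ˢ {(offspring t u, H.choose)}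
    else {offspring t u} ×ˢ Set.univ
  else Set.univ

/-- The box of vertex data given by `offspringBox` and by a set of edge labels. -/
noncomputable def dataBox (h : ℕ) (t : Finset (List ℕ)) (s u : List ℕ) (I : Set ℝ) :
    Set VertexData :=
  {z | (z.1, z.2.1) ∈ offspringBox h t s u ∧ z.2.2 ∈ I}

theorem dataBox_eq (h : ℕ) {t : Finset (List ℕ)} (ht : IsPlaneBall h t) {s : List ℕ} (hs : s ∈ t)
    (u : List ℕ) (hu : u ∈ t) :
    ∃ (A : Set ℕ) (B : Set (ℕ × ℕ)), (∀ I, dataBox h t s u I = A ×ˢ (B ×ˢ I)) ∧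
      poissonMeasure 1 A * spineLaw (poissonMeasure 1) B =
        if u.length < h then poissonMeasure 1 {offspring t u} else 1 := by
  unfold dataBox offspringBox
  by_cases hlt : u.length < h
  · by_cases H : ∃ j, j :: u <:+ s
    · refine ⟨Set.univ, {(offspring t u, H.choose)}, fun I => ?_, ?_⟩
      · ext z
        simp [hlt, H]
      · rw [spineLaw_singleton, measure_univ, one_mul, if_pos hlt]
        exact (ht.cons_mem_iff hu _).1 (ht.mem_of_suffix hs H.choose_spec)
    · refine ⟨{offspring t u}, Set.univ, fun I => ?_, ?_⟩
      · ext z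
        simp [hlt, H]
      · rw [measure_univ, mul_one, if_pos hlt]
  · refine ⟨Set.univ, Set.univ, fun I => ?_, ?_⟩
    · ext z
      simp [hlt]
    · rw [measure_univ, measure_univ, mul_one, if_neg hlt]

/-- The event that the vertices of `t` have the right numbers of children, when the special vertices
of height at most `h` are the suffixes of `s`. -/
def spineEvent (h : ℕ) (t : Finset (List ℕ)) (s : List ℕ) : Set (List ℕ → VertexData) :=
  Set.pi t fun u => dataBox h t s u Set.univ

theorem offspring_ball (ω : List ℕ → VertexData) {h : ℕ} {u : List ℕ} (hu : KestenMem ω u)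
    (hlt : u.length < h) : offspring ((kestenTree ω).ball h) u = kestenOffspring ω u := by
  have h1 : {i | i :: u ∉ (kestenTree ω).ball h} = Set.Ici (kestenOffspring ω u) := by
    ext i
    have h2 : i :: u ∈ (kestenTree ω).carrier ↔ KestenMem ω u ∧ i < kestenOffspring ω u := Iff.rfl
    rw [Set.mem_ofPred_eq, PlaneTree.mem_ball, h2, Set.mem_Ici, List.length_cons]
    constructor
    · intro H
      by_contra hc
      exact H ⟨⟨hu, by omega⟩, hlt⟩
    · rintro H ⟨⟨-, H'⟩, -⟩
      omega
  rw [offspring, h1, csInf_Ici]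

theorem mem_spineEvent {ω : List ℕ → VertexData} (hω : ∀ u, (ω u).2.1.2 < (ω u).2.1.1) (h : ℕ) :
    spine ω h ∈ (kestenTree ω).ball h ∧
      ω ∈ spineEvent h ((kestenTree ω).ball h) (spine ω h) := by
  refine ⟨((kestenTree ω).mem_ball h _).2 ⟨kestenMem_spine hω h, (length_spine ω h).le⟩, ?_⟩
  intro u hu
  obtain ⟨hmem, -⟩ := ((kestenTree ω).mem_ball h u).1 hu
  have hmem : KestenMem ω u := hmem
  refine ⟨?_, trivial⟩
  unfold offspringBox
  by_cases hlt : u.length < h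
  · rw [if_pos hlt, offspring_ball ω hmem hlt]
    by_cases H : ∃ j, j :: u <:+ spine ω h
    · rw [dif_pos H]
      have hs : IsSpecial ω (H.choose :: u) := (isSpecial_spine ω h).of_suffix H.choose_spec
      refine ⟨trivial, ?_⟩
      rw [kestenOffspring, if_pos hs.1, hs.2]
      rfl
    · rw [dif_neg H]
      refine ⟨?_, trivial⟩
      have hs : ¬ IsSpecial ω u := by
        intro hs
        have h1 := hs.eq_spine
        refine H ⟨(ω u).2.1.2, ?_⟩
        have h2 := spine_suffix ω (l := u.length + 1) (l' := h) hlt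
        rwa [spine, ← h1] at h2
      rw [kestenOffspring, if_neg hs]
      rfl
  · rw [if_neg hlt]
    trivial

theorem measurableSet_dataBox (h : ℕ) (t : Finset (List ℕ)) (s u : List ℕ) {I : Set ℝ}
    (hI : MeasurableSet I) : MeasurableSet (dataBox h t s u I) := by
  have h1 : Measurable fun z : VertexData => (z.1, z.2.1) := by fun_prop
  have h2 : Measurable fun z : VertexData => z.2.2 := by fun_prop
  exact (h1 MeasurableSet.of_discrete).inter (h2 hI)

/-- The probability that the vertices of `t` of height less than `h` have the right numbers of
children, if they are all normal. -/
noncomputable def offspringWeight (h : ℕ) (t : Finset (List ℕ)) : ENNReal :=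
  ∏ u ∈ t.filter (fun u => u.length < h), poissonMeasure 1 {offspring t u}

theorem offspringWeight_eq {h : ℕ} {t : Finset (List ℕ)} (ht : IsPlaneBall h t) :
    offspringWeight h t = ENNReal.ofReal
      ((orderCount h t : ℝ)⁻¹ * Real.exp (topCard h t - ((t.erase []).card + 1))) := by
  have h1 : (t.filter fun u => u.length < h).card + topCard h t = (t.erase []).card + 1 := by
    rw [Finset.card_erase_add_one ht.nil_mem, topCard, ← t.card_filter_add_card_filter_not
      (p := fun u => u.length < h)]
    congr 2
    refine Finset.filter_congr fun u hu => ?_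
    have := ht.length_le u hu
    omega
  have h2 : (topCard h t - ((t.erase []).card + 1) : ℝ) =
      ((t.filter fun u => u.length < h).card : ℝ) * (-1) := by
    have : (((t.filter fun u => u.length < h).card + topCard h t : ℕ) : ℝ) =
      ((t.erase []).card + 1 : ℕ) := by rw [h1]
    push_cast at this
    linarith
  rw [h2, Real.exp_nat_mul, offspringWeight, orderCount, Nat.cast_prod, ← Finset.prod_inv_distrib,
    ← Finset.prod_const, ← Finset.prod_mul_distrib, ENNReal.ofReal_prod_of_nonneg
      fun _ _ => by positivity]
  refine Finset.prod_congr rfl fun u _ => ?_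
  rw [poissonMeasure_singleton]
  congr 1
  simp
  ring

/-- All vertices of height less than `h`, special or not, contribute a Poisson mass, whatever the
position of the spine. -/
theorem kestenLaw_spineEvent {h : ℕ} {t : Finset (List ℕ)} (ht : IsPlaneBall h t) {s : List ℕ}
    (hs : s ∈ t) {O : Set (↥(t.erase []) → ℝ)} (hO : MeasurableSet O) :
    kestenLaw (spineEvent h t s ∩ {ω | (fun u : ↥(t.erase []) => kestenLabel ω u) ∈ O}) =
      offspringWeight h t * cubeMeasure ↥(t.erase []) O := by
  classical
  have hlab : Measurable fun (ω : List ℕ → VertexData) (u : ↥(t.erase [])) => kestenLabel ω u :=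
    measurable_pi_lambda _ fun u => measurable_kestenLabel u
  have hC0 : offspringWeight h t ≠ 0 := by
    rw [offspringWeight_eq ht]
    have := orderCount_pos h t
    exact (ENNReal.ofReal_pos.2 (by positivity)).ne'
  have hCtop : offspringWeight h t ≠ ⊤ := by
    rw [offspringWeight_eq ht]
    exact ENNReal.ofReal_ne_top
  have hpi : cubeMeasure ↥(t.erase []) = (offspringWeight h t)⁻¹ •
      (kestenLaw.restrict (spineEvent h t s)).map
        (fun (ω : List ℕ → VertexData) (u : ↥(t.erase [])) => kestenLabel ω u) := by
    refine Measure.pi_eq fun I hI => ?_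
    rw [Measure.smul_apply, Measure.map_apply hlab (MeasurableSet.univ_pi hI),
      Measure.restrict_apply (hlab (MeasurableSet.univ_pi hI)), smul_eq_mul]
    let I' : List ℕ → Set ℝ := fun u => if hu : u ∈ t.erase [] then I ⟨u, hu⟩ else Set.univ
    have hI' : ∀ u, MeasurableSet (I' u) := fun u => by
      by_cases hu : u ∈ t.erase []
      · simp only [I', dif_pos hu]; exact hI _
      · simp only [I', dif_neg hu]; exact MeasurableSet.univ
    have hset : (fun (ω : List ℕ → VertexData) (u : ↥(t.erase [])) => kestenLabel ω u) ⁻¹'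
        Set.univ.pi I ∩ spineEvent h t s = Set.pi t fun u => dataBox h t s u (I' u) := by
      ext ω
      constructor
      · rintro ⟨h1, h2⟩ u hu
        refine ⟨(h2 u hu).1, ?_⟩
        by_cases hu' : u ∈ t.erase []
        · simp only [I', dif_pos hu']; exact h1 ⟨u, hu'⟩ trivial
        · simp only [I', dif_neg hu']; trivial
      · intro H
        refine ⟨fun u _ => ?_, fun u hu => ⟨(H u hu).1, trivial⟩⟩
        have := (H u.1 (Finset.mem_of_mem_erase u.2)).2
        simp only [I', dif_pos u.2] at this
        exact this
    rw [hset, kestenLaw, Measure.infinitePi_pi _ fun u _ => measurableSet_dataBox h t s u (hI' u)]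
    have hfac : ∀ u ∈ t, vertexLaw (dataBox h t s u (I' u)) =
        (if u.length < h then poissonMeasure 1 {offspring t u} else 1) *
          volume.restrict (Set.Icc 0 1) (I' u) := by
      intro u hu
      obtain ⟨A, B, hAB, hw⟩ := dataBox_eq h ht hs u hu
      rw [hAB, vertexLaw_prod, ← mul_assoc, hw]
    rw [Finset.prod_congr rfl hfac, Finset.prod_mul_distrib, ← Finset.prod_filter]
    change (offspringWeight h t)⁻¹ * (offspringWeight h t * _) = _
    rw [← mul_assoc, ENNReal.inv_mul_cancel hC0 hCtop, one_mul]
    have hnil : I' [] = Set.univ := by simp [I']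
    rw [← Finset.mul_prod_erase t _ ht.nil_mem, hnil, measure_univ, one_mul,
      ← Finset.prod_coe_sort]
    refine Finset.prod_congr rfl fun u _ => ?_
    simp only [I', dif_pos u.2]
  rw [hpi, Measure.smul_apply, Measure.map_apply hlab hO, Measure.restrict_apply (hlab hO),
    smul_eq_mul, ← mul_assoc, ENNReal.mul_inv_cancel hC0 hCtop, one_mul, Set.inter_comm]
  rfl

/-- The number of words of height `h`, which is the size bias of the ball of Kesten's tree, comes
from the choice of the end of the spine. -/
theorem kestenLaw_ballEvent_le {h : ℕ} {t : Finset (List ℕ)} (ht : IsPlaneBall h t)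
    {O : Set (↥(t.erase []) → ℝ)} (hO : MeasurableSet O) :
    kestenLaw (ballEvent h t O) ≤
      topCard h t * (offspringWeight h t * cubeMeasure ↥(t.erase []) O) := by
  have h1 : ballEvent h t O ≤ᵐ[kestenLaw]
      (⋃ s ∈ t.filter (fun u => u.length = h), (spineEvent h t s ∩
        {ω | (fun u : ↥(t.erase []) => kestenLabel ω u) ∈ O}) : Set (List ℕ → VertexData)) := by
    filter_upwards [ae_specialChild_lt] with ω hω hωE
    obtain ⟨hb, hl⟩ := hωE
    obtain ⟨h2, h3⟩ := mem_spineEvent hω h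
    rw [hb] at h2 h3
    exact Set.mem_biUnion (x := spine ω h) (Finset.mem_filter.2 ⟨h2, length_spine ω h⟩) ⟨h3, hl⟩
  refine (measure_mono_ae h1).trans ((measure_biUnion_finset_le _ _).trans (le_of_eq ?_))
  rw [Finset.sum_congr rfl fun s hs => kestenLaw_spineEvent ht (Finset.mem_filter.1 hs).1 hO,
    Finset.sum_const, nsmul_eq_mul]
  rfl

/-! ### Convergence -/

instance (n : ℕ) : Nonempty (CayleyTree n) := ⟨⟨fun _ => 0, fun v => v, fun i => i.succ_pos⟩⟩

theorem measurableSet_distinctLabels :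
    MeasurableSet {ω | (kestenTree ω).DistinctLabels (kestenLabel ω)} := by
  have : {ω | (kestenTree ω).DistinctLabels (kestenLabel ω)} =
      ⋂ u : List ℕ, ⋂ v : List ℕ, {ω | (KestenMem ω u ∧ u ≠ []) → (KestenMem ω v ∧ v ≠ []) →
        kestenLabel ω u = kestenLabel ω v → u = v} := by
    ext ω
    simp only [Set.mem_iInter]
    exact ⟨fun H u v hu hv => H hu hv, fun H u hu v hv => H u v hu hv⟩
  rw [this]
  refine MeasurableSet.iInter fun u => MeasurableSet.iInter fun v => ?_
  have hmem : ∀ u : List ℕ, MeasurableSet {ω | KestenMem ω u ∧ u ≠ []} := fun u =>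
    (measurableSet_kestenMem u).inter (MeasurableSet.const _)
  exact (hmem u).imp ((hmem v).imp
    ((measurableSet_eq_fun (measurable_kestenLabel u) (measurable_kestenLabel v)).imp
      (MeasurableSet.const _)))

theorem kestenShape_mem_iff {G : Set ETree} (hG : IsOpen G) {ω : List ℕ → VertexData}
    (hω : (kestenTree ω).DistinctLabels (kestenLabel ω)) :
    kestenShape ω ∈ G ↔ ω ∈ ⋃ (h : ℕ) (t : Finset (List ℕ)), ballEvent h t (labelSet G h t) := by
  rw [kestenShape, dif_pos hω]
  simp only [Set.mem_iUnion]
  constructor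
  · intro H
    obtain ⟨h, hh⟩ := ((kestenTree ω).eventually_mem_labelSet _ hω hG H).exists
    exact ⟨h, _, rfl, hh⟩
  · rintro ⟨h, t, rfl, H⟩
    exact (kestenTree ω).shape_mem_of_mem_labelSet _ hω H

theorem measurable_kestenShape : Measurable kestenShape := by
  classical
  refine measurable_of_isOpen fun G hG => ?_
  have h1 : kestenShape ⁻¹' G =
      {ω | (kestenTree ω).DistinctLabels (kestenLabel ω)}.ite
        (⋃ (h : ℕ) (t : Finset (List ℕ)), ballEvent h t (labelSet G h t))
        {_ω | ETree.mk PointedETree.single ∈ G} := by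
    ext ω
    by_cases hω : (kestenTree ω).DistinctLabels (kestenLabel ω)
    · rw [Set.mem_preimage, kestenShape_mem_iff hG hω]
      simp [Set.ite, hω]
    · rw [Set.mem_preimage, kestenShape, dif_neg hω]
      simp [Set.ite, hω]
  rw [h1]
  refine MeasurableSet.ite measurableSet_distinctLabels ?_ (MeasurableSet.const _)
  exact MeasurableSet.iUnion fun h => MeasurableSet.iUnion fun t =>
    measurableSet_ballEvent h t (isOpen_labelSet G h t).measurableSet

/-- The part of `labelSet` where the labels are pairwise distinct. -/
def injLabelSet (G : Set ETree) (h : ℕ) (t : Finset (List ℕ)) : Set (↥(t.erase []) → ℝ) :=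
  labelSet G h t ∩ {x | Function.Injective x}

theorem isOpen_injLabelSet (G : Set ETree) (h : ℕ) (t : Finset (List ℕ)) :
    IsOpen (injLabelSet G h t) := by
  refine (isOpen_labelSet G h t).inter ?_
  have : {x : ↥(t.erase []) → ℝ | Function.Injective x} =
      ⋂ u, ⋂ v, {x | u ≠ v → x u ≠ x v} := by
    ext x
    simp only [Set.mem_iInter]
    exact ⟨fun H u v huv h => huv (H h), fun H u v h => by_contra fun huv => H u v huv h⟩
  rw [this]
  refine isOpen_iInter_of_finite fun u => isOpen_iInter_of_finite fun v => ?_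
  by_cases huv : u = v
  · simp [huv]
  · simpa [huv] using isOpen_ne_fun (continuous_apply u) (continuous_apply v)

/-- A lower bound for the probability that the ball of radius `h` of the tree of a uniform
factorization is represented by `t` with edge labels in `O`. -/
noncomputable def ballBound (h : ℕ) (t : Finset (List ℕ)) (O : Set (↥(t.erase []) → ℝ)) (n : ℕ) :
    ENNReal :=
  ENNReal.ofReal ((orderCount h t : ℝ)⁻¹ * ballRatio h t n) *
    ((Nat.card (GridPoints n O) : ENNReal) *
      ENNReal.ofReal ((n : ℝ)⁻¹ ^ Fintype.card ↥(t.erase [])))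

theorem kestenLaw_ballEvent_le_liminf {h : ℕ} {t : Finset (List ℕ)} (ht : IsPlaneBall h t)
    {O : Set (↥(t.erase []) → ℝ)} (hO : IsOpen O) :
    kestenLaw (ballEvent h t O) ≤ liminf (ballBound h t O) atTop := by
  refine (kestenLaw_ballEvent_le ht hO.measurableSet).trans ?_
  have h1 : Tendsto (fun n => ENNReal.ofReal ((orderCount h t : ℝ)⁻¹ * ballRatio h t n)) atTop
      (𝓝 (topCard h t * offspringWeight h t)) := by
    have h2 := ENNReal.tendsto_ofReal ((tendsto_ballRatio h t).const_mul (orderCount h t : ℝ)⁻¹)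
    convert h2 using 2
    rw [offspringWeight_eq ht, ← ENNReal.ofReal_natCast, ← ENNReal.ofReal_mul (by positivity)]
    congr 1
    ring
  rw [← mul_assoc, ← h1.liminf_eq]
  exact (mul_le_mul_right (cubeMeasure_le_liminf _ hO) _).trans ENNReal.le_liminf_mul

theorem ofReal_mul_card_le {n : ℕ} (Q : Set (CayleyTree n)) :
    ENNReal.ofReal (((n : ℝ) + 1) / ((n : ℝ) + 1) ^ n * Nat.card Q) ≤
      Nat.card Q / Nat.card (CayleyTree n) := by
  have h1 : (0 : ℝ) < Nat.card (CayleyTree n) := by exact_mod_cast Nat.card_pos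
  have h2 : (Nat.card (CayleyTree n) : ℝ) * ((n : ℝ) + 1) ≤ ((n : ℝ) + 1) ^ n := by
    exact_mod_cast CayleyTree.card_mul_le (n := n)
  rw [← ENNReal.ofReal_natCast, ← ENNReal.ofReal_natCast, ← ENNReal.ofReal_div_of_pos h1]
  refine ENNReal.ofReal_le_ofReal ?_
  rw [div_mul_eq_mul_div, div_le_div_iff₀ (by positivity) h1]
  calc ((n : ℝ) + 1) * Nat.card Q * Nat.card (CayleyTree n)
      = Nat.card Q * (Nat.card (CayleyTree n) * ((n : ℝ) + 1)) := by ring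
    _ ≤ _ := by gcongr

open Classical in
theorem tsum_ballBound_le {n h : ℕ} (hn : 0 < n)
    (O : ∀ t : Finset (List ℕ), Set (↥(t.erase []) → ℝ))
    (hO : ∀ t, ∀ x ∈ O t, Function.Injective x) (Q : Set (CayleyTree n))
    (hQ : ∀ (p : CayleyTree n) (t : Finset (List ℕ)) (y : ↥(t.erase []) → Fin n),
      IsTreeChart h p t y → (fun u => ((y u : ℝ) + 1) / ((n : ℝ) + 1)) ∈ O t → p ∈ Q) :
    ∑' t, (if IsPlaneBall h t then ballBound h t (O t) n else 0) ≤
      (Nat.card Q : ENNReal) / Nat.card (CayleyTree n) := by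
  rw [ENNReal.tsum_eq_iSup_sum]
  refine iSup_le fun T => ?_
  rw [← Finset.sum_filter]
  have hn' : (0 : ℝ) < n := by exact_mod_cast hn
  have hterm : ∀ t : Finset (List ℕ), ballBound h t (O t) n =
      ENNReal.ofReal (((n : ℝ) + 1) / ((n : ℝ) + 1) ^ n *
        ((orderCount h t : ℝ)⁻¹ * forestCount h t n * Nat.card (GridPoints n (O t)))) := by
    intro t
    have hf : 0 ≤ forestCount h t n := by
      unfold forestCount
      positivity
    rw [ballBound, ← ENNReal.ofReal_natCast, ← ENNReal.ofReal_mul (by positivity),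
      ← ENNReal.ofReal_mul (by unfold ballRatio; positivity), ballRatio, Fintype.card_coe]
    congr 1
    rw [inv_pow]
    field_simp
  simp only [hterm]
  rw [← ENNReal.ofReal_sum_of_nonneg, ← Finset.mul_sum]
  · refine le_trans (ENNReal.ofReal_le_ofReal ?_) (ofReal_mul_card_le Q)
    exact mul_le_mul_of_nonneg_left (sum_forestCount_mul_le (T.filter fun t => IsPlaneBall h t)
      (fun t ht => (Finset.mem_filter.1 ht).2) O hO Q hQ) (by positivity)
  · intro t _
    have hf : 0 ≤ forestCount h t n := by
      unfold forestCount
      positivity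
    positivity

theorem kestenLaw_iUnion_ballEvent_le_liminf (h : ℕ)
    (O : ∀ t : Finset (List ℕ), Set (↥(t.erase []) → ℝ)) (hOopen : ∀ t, IsOpen (O t))
    (hO : ∀ t, ∀ x ∈ O t, Function.Injective x) (Q : ∀ n, Set (CayleyTree n))
    (hQ : ∀ n (p : CayleyTree n) (t : Finset (List ℕ)) (y : ↥(t.erase []) → Fin n),
      IsTreeChart h p t y → (fun u => ((y u : ℝ) + 1) / ((n : ℝ) + 1)) ∈ O t → p ∈ Q n) :
    kestenLaw (⋃ t, ballEvent h t (O t)) ≤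
      liminf (fun n => (Nat.card (Q n) : ENNReal) / Nat.card (CayleyTree n)) atTop := by
  classical
  have h1 : ∀ t, kestenLaw (ballEvent h t (O t)) ≤
      liminf (fun n => if IsPlaneBall h t then ballBound h t (O t) n else 0) atTop := by
    intro t
    by_cases ht : IsPlaneBall h t
    · simp only [ht, if_true]
      exact kestenLaw_ballEvent_le_liminf ht (hOopen t)
    · have : ballEvent h t (O t) = ∅ := by
        refine Set.eq_empty_of_forall_notMem fun ω hω => ht ?_
        rw [← hω.1]
        exact (kestenTree ω).isPlaneBall_ball h
      rw [this, measure_empty]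
      exact zero_le
  refine (measure_iUnion_le _).trans ((ENNReal.tsum_le_tsum h1).trans
    ((tsum_liminf_le _).trans (liminf_le_liminf ?_)))
  filter_upwards [eventually_gt_atTop 0] with n hn
  exact tsum_ballBound_le hn O hO (Q n) (hQ n)

theorem kestenLaw_preimage_le_liminf {G : Set ETree} (hG : IsOpen G)
    (Q : ∀ n, Set (CayleyTree n))
    (hQ : ∀ n h (p : CayleyTree n) (t : Finset (List ℕ)) (y : ↥(t.erase []) → Fin n),
      IsTreeChart h p t y →
      (fun u => ((y u : ℝ) + 1) / ((n : ℝ) + 1)) ∈ labelSet G h t → p ∈ Q n) :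
    kestenLaw (kestenShape ⁻¹' G) ≤
      liminf (fun n => (Nat.card (Q n) : ENNReal) / Nat.card (CayleyTree n)) atTop := by
  let D : Set (List ℕ → VertexData) := {ω | ∀ u v, u ≠ v → kestenLabel ω u ≠ kestenLabel ω v}
  have hDm : MeasurableSet D := by
    have : D = ⋂ u : List ℕ, ⋂ v : List ℕ, {ω | u ≠ v → kestenLabel ω u ≠ kestenLabel ω v} := by
      ext ω
      simp only [Set.mem_iInter]
      rfl
    rw [this]
    exact MeasurableSet.iInter fun u => MeasurableSet.iInter fun v => (MeasurableSet.const _).imp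
      (measurableSet_eq_fun (measurable_kestenLabel u) (measurable_kestenLabel v)).compl
  have h1 : kestenLaw (kestenShape ⁻¹' G) ≤ kestenLaw (kestenShape ⁻¹' G ∩ D) := by
    refine measure_mono_ae ?_
    filter_upwards [ae_kestenLabel_ne] with ω hω hωG
    exact ⟨hωG, hω⟩
  have h2 := measure_le_liminf_of_eventually_mem (μ := kestenLaw)
    (E := fun h => ⋃ t, ballEvent h t (injLabelSet G h t))
    ((measurable_kestenShape hG.measurableSet).inter hDm)
    (fun h => MeasurableSet.iUnion fun t =>
      measurableSet_ballEvent h t (isOpen_injLabelSet G h t).measurableSet) (by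
      rintro ω ⟨hωG, hωD⟩
      have hω : (kestenTree ω).DistinctLabels (kestenLabel ω) := by
        intro u _ v _ huv
        by_contra hne
        exact hωD u v hne huv
      have hωG : kestenShape ω ∈ G := hωG
      rw [kestenShape, dif_pos hω] at hωG
      filter_upwards [(kestenTree ω).eventually_mem_labelSet _ hω hG hωG] with h hh
      refine Set.mem_iUnion.2 ⟨_, rfl, hh, fun u v huv => ?_⟩
      by_contra hne
      exact hωD u v (fun h => hne (Subtype.ext h)) huv)
  refine h1.trans (h2.trans ?_)
  refine (liminf_le_liminf (Eventually.of_forall fun h =>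
    kestenLaw_iUnion_ballEvent_le_liminf h (injLabelSet G h) (isOpen_injLabelSet G h)
      (fun t x hx => hx.2) Q fun n p t y hy hx => hQ n h p t y hy hx.1)).trans ?_
  rw [liminf_const]

instance (n : ℕ) : Finite (MinimalFactorization n) := Subtype.finite

/-- A uniform minimal factorization is coded by a uniform Cayley tree. -/
theorem card_div_card_le_uniformOn {n : ℕ} (S : Set (MinimalFactorization (n + 1))) :
    (Nat.card {p : CayleyTree n | ∀ F : MinimalFactorization (n + 1), F.Codes p → F ∈ S} :
      ENNReal) / Nat.card (CayleyTree n) ≤ uniformOn Set.univ S := by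
  have := Fintype.ofFinite (MinimalFactorization (n + 1))
  obtain ⟨f, hf, hcodes⟩ := MinimalFactorization.exists_bijective_codes n
  have h1 : Nat.card (CayleyTree n) = Fintype.card (MinimalFactorization (n + 1)) := by
    rw [← Nat.card_eq_fintype_card, Nat.card_congr (Equiv.ofBijective f hf)]
  have h2 : Measure.count S = (Nat.card S : ENNReal) := by
    rw [Measure.count_apply_finite' S.toFinite MeasurableSpace.measurableSet_top,
      Nat.card_eq_card_finite_toFinset]
  have h3 : Nat.card {p : CayleyTree n | ∀ F : MinimalFactorization (n + 1), F.Codes p → F ∈ S} ≤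
      Nat.card S := by
    refine Nat.card_le_card_of_injective
      (fun p => ⟨(Equiv.ofBijective f hf).symm p.1, p.2 _ ?_⟩) ?_
    · have := hcodes ((Equiv.ofBijective f hf).symm p.1)
      rwa [show f ((Equiv.ofBijective f hf).symm p.1) = p.1 from
        (Equiv.ofBijective f hf).apply_symm_apply p.1] at this
    · intro p q hpq
      exact Subtype.ext ((Equiv.ofBijective f hf).symm.injective (congrArg Subtype.val hpq))
  rw [uniformOn_univ, h2, h1]
  gcongr

theorem mainTheorem6 {Ω : ℕ → Type*} [∀ n, MeasurableSpace (Ω n)]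
    (P : ∀ n, Measure (Ω n)) [∀ n, IsProbabilityMeasure (P n)]
    (F : ∀ n, Ω n → MinimalFactorization (n + 1))
    (hF : ∀ n, HasLaw (F n) (uniformOn Set.univ) (P n)) :
    TendstoInDistribution
      (fun n ω => ETree.scale (1 / ((n + 1 : ℕ) : ℝ)) (by positivity) (F n ω).toETree)
      atTop kestenShape P kestenLaw := by
  have hpos : ∀ n : ℕ, 0 < 1 / ((n + 1 : ℕ) : ℝ) := fun n => by positivity
  let g : ∀ n, MinimalFactorization (n + 1) → ETree := fun n F' =>
    ETree.scale (1 / ((n + 1 : ℕ) : ℝ)) (hpos n) F'.toETree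
  have hX : ∀ n, AEMeasurable (fun ω => g n (F n ω)) (P n) := fun n =>
    (measurable_from_top (f := g n)).comp_aemeasurable (hF n).aemeasurable
  refine ⟨hX, measurable_kestenShape.aemeasurable, ?_⟩
  refine tendsto_of_forall_isOpen_le_liminf' fun G hG => ?_
  change kestenLaw.map kestenShape G ≤ liminf (fun n => (P n).map (fun ω => g n (F n ω)) G) atTop
  rw [Measure.map_apply measurable_kestenShape hG.measurableSet]
  refine (kestenLaw_preimage_le_liminf hG
    (fun n => {p | ∀ F' : MinimalFactorization (n + 1), F'.Codes p → F' ∈ g n ⁻¹' G})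
    fun n h p t y hy hG F' hF' => hF'.scale_mem hy hG (hpos n)).trans
    (liminf_le_liminf (Eventually.of_forall fun n => ?_))
  refine (card_div_card_le_uniformOn (g n ⁻¹' G)).trans (le_of_eq ?_)
  rw [← (hF n).map_eq, Measure.map_apply_of_aemeasurable (hF n).aemeasurable
    MeasurableSpace.measurableSet_top,
    Measure.map_apply_of_aemeasurable (hX n) hG.measurableSet]
  rfl
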